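/- Consider equations of the class $$v_t=v_{xx}+F(x)v_x+\varepsilon e^{v}+H(x),\qquad(\ast)$$ where $F$ and $H$ are smooth functions on an open subset $I$ of $\mathbb R$ and $\varepsilon\in\{1,-1\}$. A point transformation on an open set $\Omega\subseteq\mathbb R^3$ of variables $(t,x,v)$ is a smooth map $\varphi\colon(t,x,v)\mapsto(\tilde t,\tilde x,\tilde v)$ on $\Omega$ with nonvanishing Jacobian. It is called admissible for two equations of the class, with parameters $(F,H,\varepsilon)$ on $I$ and $(\tilde F,\tilde H,\tilde\varepsilon)$ on $\tilde I$ (where $x\in I$ and $\tilde x\in\tilde I$ on $\Omega$), if it turns the first equation into the second one, that is, its prolongation to second-order jets identifies the submanifolds of the jet space given by the two equations: whenever $\varphi$ maps the graph of a smooth function $u$ near a point of $\Omega$ into the graph of a smooth function $\tilde u$, the function $u$ satisfies the first equation at the point if and only if $\tilde u$ satisfies the second one at the corresponding point. Suppose that $\Omega$ is connected (in particular nonempty) and that its sections by the planes $t=\mathrm{const}$ are connected or empty. Then $\varphi$ is an admissible point transformation between the two equations if and only if on $\Omega$ it has the form $$\tilde t=T(t),\quad \tilde x=\delta\sqrt{T_t}\,x+X(t),\quad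 \tilde v=v-\ln T_t,$$ where $\delta=\pm1$ is a constant and $T$ and $X$ are smooth functions of $t$ with $T_t>0$, and for all $(t,x,v)\in\Omega$ the parameters of the equations are related by $$\tilde F(\tilde x)=\frac{\delta}{\sqrt{T_t}}F(x)-\frac{\delta}{2}\,\frac{T_{tt}}{\sqrt{T_t^{\,3}}}\,x-\frac{X_t}{T_t},\qquad \tilde H(\tilde x)=\frac1{T_t}H(x)-\frac{T_{tt}}{T_t^{\,2}},\qquad \tilde\varepsilon=\varepsilon .$$ For an arbitrary open set $\Omega$, $\varphi$ is admissible if and only if every point of $\Omega$ has an open neighbourhood in $\Omega$ on which $\varphi$ has this form and these relations hold. -/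

import Mathlib

open Set Filter Topology
open scoped ContDiff

/-- An equation `v_t = v_xx + F(x) v_x + ε e^v + H(x)` of the class: `F` and `H` are smooth functions
of `x` on an open set `I` of the real line (so that, e.g., `F(x) = α / x` is covered) and
`ε` is a sign. -/
structure ImagedEquation where
  I : Set ℝ
  isOpen_I : IsOpen I
  F : ℝ → ℝ
  H : ℝ → ℝ
  ε : ℝ
  smooth_F : ContDiffOn ℝ ∞ F I
  smooth_H : ContDiffOn ℝ ∞ H I
  sign_ε : ε = 1 ∨ ε = -1

/-- The part of the space of the variables `(t, x, v)` over which the equation is defined. -/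
def ImagedEquation.domain (E : ImagedEquation) : Set (ℝ × ℝ × ℝ) := {z | z.2.1 ∈ E.I}

/-- The function `u` of `(t, x)` satisfies the equation at the point `p = (t, x)`. It is only used
for `u` smooth near `p`. -/
def ImagedEquation.HoldsAt (E : ImagedEquation) (u : ℝ × ℝ → ℝ) (p : ℝ × ℝ) : Prop :=
  deriv (fun s => u (s, p.2)) p.1 =
    deriv (deriv (fun y => u (p.1, y))) p.2 + E.F p.2 * deriv (fun y => u (p.1, y)) p.2
      + E.ε * Real.exp (u p) + E.H p.2

/-- `u` is smooth in a neighbourhood of `p`. -/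
def SmoothNear (u : ℝ × ℝ → ℝ) (p : ℝ × ℝ) : Prop :=
  ∃ U ∈ 𝓝 p, ContDiffOn ℝ ∞ u U

/-- A point transformation of the space of the variables `(t, x, v)`, defined on `Ω`: a smooth map
with nonvanishing Jacobian. -/
structure IsPointTransformation (φ : ℝ × ℝ × ℝ → ℝ × ℝ × ℝ) (Ω : Set (ℝ × ℝ × ℝ)) : Prop where
  smooth : ContDiffOn ℝ ∞ φ Ω
  jacobian_ne_zero : ∀ z ∈ Ω, (fderiv ℝ φ z).det ≠ 0

/-- `φ` maps the graph of `u` near the point over `p` into the graph of `u'`, i.e. `u'` is the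
function obtained from `u` by the change of variables `φ`. -/
def Transforms (φ : ℝ × ℝ × ℝ → ℝ × ℝ × ℝ) (u u' : ℝ × ℝ → ℝ) (p : ℝ × ℝ) : Prop :=
  ∀ᶠ q in 𝓝 p,
    u' ((φ (q.1, q.2, u q)).1, (φ (q.1, q.2, u q)).2.1) = (φ (q.1, q.2, u q)).2.2

/-- The change of variables `φ` turns the equation `E` into the equation `E'`: the prolongation of
`φ` to second-order jets identifies the submanifolds of the jet space that are given by `E` and `E'`.
A second-order jet is represented by a smooth function `u` near a point `p` and its transformed jet
by the transformed function `u'` near the corresponding point. -/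
def Connects (E E' : ImagedEquation) (φ : ℝ × ℝ × ℝ → ℝ × ℝ × ℝ) (Ω : Set (ℝ × ℝ × ℝ)) : Prop :=
  ∀ (u u' : ℝ × ℝ → ℝ) (p : ℝ × ℝ), (p.1, p.2, u p) ∈ Ω → SmoothNear u p →
    SmoothNear u' ((φ (p.1, p.2, u p)).1, (φ (p.1, p.2, u p)).2.1) →
    Transforms φ u u' p →
    (E.HoldsAt u p ↔ E'.HoldsAt u' ((φ (p.1, p.2, u p)).1, (φ (p.1, p.2, u p)).2.1))

/-- `(E, E', φ)` is an admissible transformation: a point transformation connecting `E` with `E'`. -/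
structure IsAdmissible (E E' : ImagedEquation) (φ : ℝ × ℝ × ℝ → ℝ × ℝ × ℝ)
    (Ω : Set (ℝ × ℝ × ℝ)) : Prop where
  point : IsPointTransformation φ Ω
  connects : Connects E E' φ Ω

/-- On `W` one has `t̃ = T(t)`, `x̃ = δ √T_t x + X(t)`, `ṽ = v - ln T_t` with `δ = ±1`, `T` and `X`
smooth functions of `t`, `T_t > 0`; and the coefficients of `E` and `E'` are related by
`F̃ = δ/√T_t F - (δ/2) T_tt/√(T_t³) x - X_t/T_t`, `H̃ = H/T_t - T_tt/T_t²`, `ε̃ = ε`. -/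
def HasAdmissibleForm (E E' : ImagedEquation) (φ : ℝ × ℝ × ℝ → ℝ × ℝ × ℝ)
    (W : Set (ℝ × ℝ × ℝ)) : Prop :=
  ∃ (δ : ℝ) (T X : ℝ → ℝ), (δ = 1 ∨ δ = -1) ∧
    ContDiffOn ℝ ∞ T (Prod.fst '' W) ∧ ContDiffOn ℝ ∞ X (Prod.fst '' W) ∧
    (∀ t ∈ Prod.fst '' W, 0 < deriv T t) ∧
    (∀ t x v : ℝ, (t, x, v) ∈ W →
      φ (t, x, v) = (T t, δ * √(deriv T t) * x + X t, v - Real.log (deriv T t)) ∧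
      E'.F (δ * √(deriv T t) * x + X t) =
        δ / √(deriv T t) * E.F x - δ / 2 * (deriv (deriv T) t / √(deriv T t ^ 3)) * x
          - deriv X t / deriv T t ∧
      E'.H (δ * √(deriv T t) * x + X t) =
        1 / deriv T t * E.H x - deriv (deriv T) t / deriv T t ^ 2) ∧
    E'.ε = E.ε

/-!
Write `φ = (T, X, V)`. The form and the relations of the theorem are equivalent to a system of
pointwise equations, `DeterminingEquations`: `T_x = T_v = X_v = 0`, `X_x² = T_t > 0`,
`V = v - ln T_t`, `T_t F'(X) = X_x F - X_t`, `T_t² H'(X) = T_t H - T_tt` and `ε' = ε`. Since the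
system is pointwise, the local and the global statement follow from the same lemmas.

*Sufficiency* (`isAdmissible_of_determiningEquations`). Differentiating the relation
`u' (T, X) = V` along the graph of `u` once and twice (`prolongation`) expresses the derivatives of
`u'` through those of `u`. Under the determining equations the two equations then differ by the
factor `T_t`.

*Necessity* (`AdmissibleTriple.determiningEquations`). Every jet of `u` for which the total Jacobian
of `(T, X)` is nonzero is realized by a quadratic polynomial, and the inverse function theorem
provides `u'` (`exists_transforms`), so that admissibility becomes a condition on jets
(`IsAdmissible.jet_condition`). The derivatives of `u` are then varied one after another. A second
derivative of `u` enters the prolongation with the coefficient `u'_t T_v + u'_x X_v - V_v`, which is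
nonzero because the Jacobian of `φ` is (`AdmissibleTriple.covector_ne`).
* Varying `u_tt` gives `T_x + u_x T_v = 0` for at least two values of `u_x`, hence `T = T(t)`.
* Varying `u_xx` together with `u_t` gives `(X_x + u_x X_v)² = T_t`, hence `X_v = 0`, `X_x² = T_t`.
* What remains is a quadratic polynomial identity in `u_x` (`AdmissibleTriple.splitting`). The
  coefficient of `u_x²` is `V_vv`, so `V` is affine in `v`; in the free term everything is then
  affine in `v` except for the two exponentials, which have to match (`exponent_eq_one`). This gives
  `V_v = 1`, `ε' = ε` and `V = v - ln T_t`, and the remaining coefficients are the relations for `F`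
  and `H`.

*Integration* (`AdmissibleTriple.hasAdmissibleForm`). If the sections `t = const` are connected, `T`
and `X - X_x x`, whose `x`- and `v`-derivatives vanish, are functions of `t`; if the whole set is
connected, the sign of `X_x = ± √T_t` is constant. Balls have both properties, which gives the local
statement.
-/

/-! ### Directional derivatives and second-order jets of curves -/

section Calculus

variable {A B : Type*} [NormedAddCommGroup A] [NormedSpace ℝ A]
  [NormedAddCommGroup B] [NormedSpace ℝ B]

/-- The derivative of `f` in the direction `w`, as a function of the point; partial derivatives on
a product are derivatives in the coordinate directions. -/
noncomputable def dirD (w : A) (f : A → ℝ) (z : A) : ℝ := fderiv ℝ f z w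

theorem ContDiffAt.dirD {f : A → ℝ} {z : A} (hf : ContDiffAt ℝ ∞ f z) (w : A) :
    ContDiffAt ℝ ∞ (dirD w f) z :=
  (hf.fderiv_right (m := ∞) (by simp)).clm_apply contDiffAt_const

theorem dirD_eventuallyEq {f g : A → ℝ} {z : A} (h : f =ᶠ[𝓝 z] g) (w : A) :
    dirD w f =ᶠ[𝓝 z] dirD w g := by
  filter_upwards [h.fderiv (𝕜 := ℝ)] with y hy
  simp only [dirD, hy]

theorem dirD_eq_zero_of_eventually_eq {f : A → ℝ} {z : A} {k : ℝ} (h : ∀ᶠ y in 𝓝 z, f y = k)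
    (w : A) : dirD w f z = 0 := by
  have h' : f =ᶠ[𝓝 z] fun _ => k := h
  rw [(dirD_eventuallyEq h' w).eq_of_nhds]
  simp [dirD]

theorem dirD_dirD {f : A → ℝ} {z : A} (hf : ContDiffAt ℝ ∞ f z) (w w' : A) :
    dirD w (dirD w' f) z = fderiv ℝ (fderiv ℝ f) z w w' := by
  have h : DifferentiableAt ℝ (fderiv ℝ f) z :=
    (hf.fderiv_right (m := ∞) (by simp)).differentiableAt (by simp)
  have : fderiv ℝ (dirD w' f) z = _ := (h.hasFDerivAt.clm_apply (hasFDerivAt_const w' z)).fderiv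
  rw [dirD, this]
  simp

theorem dirD_comm {f : A → ℝ} {z : A} (hf : ContDiffAt ℝ ∞ f z) (w w' : A) :
    dirD w (dirD w' f) z = dirD w' (dirD w f) z := by
  rw [dirD_dirD hf, dirD_dirD hf]
  have h2 : ContDiffAt ℝ 2 f z := hf.of_le ENat.LEInfty.out
  exact (h2.isSymmSndFDerivAt (by simp)).eq _ _

/-- The curve `c` is twice differentiable at `s₀`, with first derivative `c₁` and second
derivative `c₂` there. -/
def HasJetAt (c : ℝ → A) (c₁ c₂ : A) (s₀ : ℝ) : Prop :=
  ∃ c' : ℝ → A, (∀ᶠ s in 𝓝 s₀, HasDerivAt c (c' s) s) ∧ c' s₀ = c₁ ∧ HasDerivAt c' c₂ s₀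

theorem HasJetAt.continuousAt {c : ℝ → A} {c₁ c₂ : A} {s₀ : ℝ} (h : HasJetAt c c₁ c₂ s₀) :
    ContinuousAt c s₀ := by
  obtain ⟨c', h1, -, -⟩ := h
  exact h1.self_of_nhds.continuousAt

theorem HasJetAt.prodMk {c : ℝ → A} {c₁ c₂ : A} {d : ℝ → B} {d₁ d₂ : B} {s₀ : ℝ}
    (hc : HasJetAt c c₁ c₂ s₀) (hd : HasJetAt d d₁ d₂ s₀) :
    HasJetAt (fun s => (c s, d s)) (c₁, d₁) (c₂, d₂) s₀ := by
  obtain ⟨c', h1, h2, h3⟩ := hc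
  obtain ⟨d', k1, k2, k3⟩ := hd
  refine ⟨fun s => (c' s, d' s), ?_, by simp [h2, k2], h3.prodMk k3⟩
  filter_upwards [h1, k1] with s hs ks using hs.prodMk ks

theorem HasJetAt.unique {c d : ℝ → A} {c₁ c₂ d₁ d₂ : A} {s₀ : ℝ}
    (hc : HasJetAt c c₁ c₂ s₀) (hd : HasJetAt d d₁ d₂ s₀) (h : c =ᶠ[𝓝 s₀] d) :
    c₁ = d₁ ∧ c₂ = d₂ := by
  obtain ⟨c', h1, h2, h3⟩ := hc
  obtain ⟨d', k1, k2, k3⟩ := hd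
  have e : c' =ᶠ[𝓝 s₀] d' := by
    filter_upwards [h1, k1, h.eventuallyEq_nhds] with s hs ks es
    exact hs.unique (ks.congr_of_eventuallyEq es)
  refine ⟨by rw [← h2, ← k2, e.eq_of_nhds], h3.unique (k3.congr_of_eventuallyEq e)⟩

/-- The chain rule to second order along a curve. -/
theorem HasJetAt.comp {f : A → ℝ} {c : ℝ → A} {c₁ c₂ : A} {s₀ : ℝ}
    (hc : HasJetAt c c₁ c₂ s₀) (hf : ContDiffAt ℝ ∞ f (c s₀)) :
    HasJetAt (fun s => f (c s)) (dirD c₁ f (c s₀))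
      (dirD c₁ (dirD c₁ f) (c s₀) + dirD c₂ f (c s₀)) s₀ := by
  have hcont := hc.continuousAt
  obtain ⟨c', h1, h2, h3⟩ := hc
  refine ⟨fun s => fderiv ℝ f (c s) (c' s), ?_, by simp [dirD, h2], ?_⟩
  · have hd : ∀ᶠ y in 𝓝 (c s₀), DifferentiableAt ℝ f y := by
      filter_upwards [(hf.of_le (m := 1) (by simp)).eventually (by simp)] with y hy
      exact hy.differentiableAt (by simp)
    filter_upwards [h1, hcont.eventually hd] with s hs hy
    exact hy.hasFDerivAt.comp_hasDerivAt s hs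
  · have h : DifferentiableAt ℝ (fderiv ℝ f) (c s₀) :=
      (hf.fderiv_right (m := ∞) (by simp)).differentiableAt (by simp)
    have := (h.hasFDerivAt.comp_hasDerivAt s₀ h1.self_of_nhds).clm_apply h3
    rw [dirD_dirD hf]
    simpa [dirD, h2] using this

theorem hasJetAt_line (p ξ : A) : HasJetAt (fun s : ℝ => p + s • ξ) ξ 0 0 := by
  refine ⟨fun _ => ξ, Eventually.of_forall fun s => ?_, rfl, hasDerivAt_const _ _⟩
  simpa using ((hasDerivAt_id s).smul_const ξ).const_add p

end Calculus

/-! ### Prolongation to second-order jets -/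

theorem deriv_fst_eq_dirD {u : ℝ × ℝ → ℝ} {p : ℝ × ℝ} (hu : ContDiffAt ℝ ∞ u p) :
    deriv (fun s => u (s, p.2)) p.1 = dirD (1, 0) u p := by
  have h1 : HasDerivAt (fun s : ℝ => (s, p.2)) ((1 : ℝ), (0 : ℝ)) p.1 :=
    (hasDerivAt_id p.1).prodMk (hasDerivAt_const _ _)
  exact ((hu.differentiableAt (by simp)).hasFDerivAt.comp_hasDerivAt (f := fun s : ℝ => (s, p.2))
    p.1 h1).deriv

theorem deriv_snd_eq_dirD {u : ℝ × ℝ → ℝ} {p : ℝ × ℝ} (hu : DifferentiableAt ℝ u p) :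
    deriv (fun y => u (p.1, y)) p.2 = dirD (0, 1) u p := by
  have h1 : HasDerivAt (fun s : ℝ => (p.1, s)) ((0 : ℝ), (1 : ℝ)) p.2 :=
    (hasDerivAt_const _ _).prodMk (hasDerivAt_id p.2)
  exact (hu.hasFDerivAt.comp_hasDerivAt (f := fun s : ℝ => (p.1, s)) p.2 h1).deriv

theorem deriv_deriv_snd_eq_dirD {u : ℝ × ℝ → ℝ} {p : ℝ × ℝ} (hu : ContDiffAt ℝ ∞ u p) :
    deriv (deriv (fun y => u (p.1, y))) p.2 = dirD (0, 1) (dirD (0, 1) u) p := by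
  have hd : ∀ᶠ y in 𝓝 p, DifferentiableAt ℝ u y := by
    filter_upwards [(hu.of_le (m := 1) (by simp)).eventually (by simp)] with y hy
    exact hy.differentiableAt (by simp)
  have hc : ContinuousAt (fun s : ℝ => (p.1, s)) p.2 := by fun_prop
  have : deriv (fun y => u (p.1, y)) =ᶠ[𝓝 p.2] fun y => dirD (0, 1) u (p.1, y) := by
    filter_upwards [hc.eventually hd] with y hy
    exact deriv_snd_eq_dirD hy
  rw [this.deriv_eq]
  exact deriv_snd_eq_dirD ((hu.dirD (0, 1)).differentiableAt (by simp))

theorem ImagedEquation.holdsAt_iff (E : ImagedEquation) {u : ℝ × ℝ → ℝ} {p : ℝ × ℝ}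
    (hu : ContDiffAt ℝ ∞ u p) :
    E.HoldsAt u p ↔ dirD (1, 0) u p = dirD (0, 1) (dirD (0, 1) u) p
      + E.F p.2 * dirD (0, 1) u p + E.ε * Real.exp (u p) + E.H p.2 := by
  rw [ImagedEquation.HoldsAt, deriv_fst_eq_dirD hu, deriv_snd_eq_dirD (hu.differentiableAt (by simp)),
    deriv_deriv_snd_eq_dirD hu]

theorem SmoothNear.contDiffAt {u : ℝ × ℝ → ℝ} {p : ℝ × ℝ} (h : SmoothNear u p) :
    ContDiffAt ℝ ∞ u p := by
  obtain ⟨U, hU, h⟩ := h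
  exact h.contDiffAt hU

theorem dirD_prod_real (f : ℝ × ℝ → ℝ) (p : ℝ × ℝ) (x y : ℝ) :
    dirD (x, y) f p = x * dirD (1, 0) f p + y * dirD (0, 1) f p := by
  have : ((x, y) : ℝ × ℝ) = x • (1, 0) + y • (0, 1) := by simp
  simp only [dirD]
  rw [this, map_add, map_smul, map_smul]; simp

theorem dirD_prod_prod (f : ℝ × ℝ × ℝ → ℝ) (z : ℝ × ℝ × ℝ) (x y w : ℝ) :
    dirD (x, y, w) f z = x * dirD (1, 0, 0) f z + y * dirD (0, 1, 0) f z
      + w * dirD (0, 0, 1) f z := by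
  have : ((x, y, w) : ℝ × ℝ × ℝ) = x • (1, 0, 0) + y • (0, 1, 0) + w • (0, 0, 1) := by simp
  simp only [dirD]
  rw [this, map_add, map_add, map_smul, map_smul, map_smul]; simp

/-- The formulas for the prolongation of `φ = (T, X, V)` along the direction `ξ`, with
`τ` the lift of `ξ` to the tangent plane of the graph of `u`. The second one determines the
transformed second derivative when `τ` is annihilated by `dT`. -/
theorem prolongation {φ : ℝ × ℝ × ℝ → ℝ × ℝ × ℝ} {u u' : ℝ × ℝ → ℝ} {p : ℝ × ℝ}
    {T X V : ℝ × ℝ × ℝ → ℝ} (hφ : φ = fun z => (T z, X z, V z))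
    {z : ℝ × ℝ × ℝ} (hz : z = (p.1, p.2, u p))
    (hT : ContDiffAt ℝ ∞ T z) (hX : ContDiffAt ℝ ∞ X z) (hV : ContDiffAt ℝ ∞ V z)
    (hu : ContDiffAt ℝ ∞ u p) (hu' : ContDiffAt ℝ ∞ u' (T z, X z))
    (htr : Transforms φ u u' p) (ξ : ℝ × ℝ) {τ : ℝ × ℝ × ℝ}
    (hτ : τ = (ξ.1, ξ.2, dirD ξ u p)) :
    dirD (1, 0) u' (T z, X z) * dirD τ T z + dirD (0, 1) u' (T z, X z) * dirD τ X z = dirD τ V z ∧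
    (dirD τ T z = 0 →
      dirD (0, 1) (dirD (0, 1) u') (T z, X z) * dirD τ X z ^ 2
        + dirD (1, 0) u' (T z, X z)
          * (dirD τ (dirD τ T) z + dirD ξ (dirD ξ u) p * dirD (0, 0, 1) T z)
        + dirD (0, 1) u' (T z, X z)
          * (dirD τ (dirD τ X) z + dirD ξ (dirD ξ u) p * dirD (0, 0, 1) X z)
      = dirD τ (dirD τ V) z + dirD ξ (dirD ξ u) p * dirD (0, 0, 1) V z) := by
  have hl := hasJetAt_line p ξ
  have hl0 : p + (0 : ℝ) • ξ = p := by simp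
  have hl1 : HasJetAt (fun s : ℝ => p.1 + s * ξ.1) ξ.1 0 0 := by
    simpa using hasJetAt_line p.1 ξ.1
  have hl2 : HasJetAt (fun s : ℝ => p.2 + s * ξ.2) ξ.2 0 0 := by
    simpa using hasJetAt_line p.2 ξ.2
  have hlu := hl.comp (f := u) (by rwa [hl0])
  rw [hl0] at hlu
  have hg := hl1.prodMk (hl2.prodMk hlu)
  set γ : ℝ → ℝ × ℝ × ℝ := fun s => (p.1 + s * ξ.1, p.2 + s * ξ.2, u (p + s • ξ)) with hγ
  have hγ0 : γ 0 = z := by simp [hγ, hz]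
  have h0 : dirD (0 : ℝ × ℝ) u p = 0 := by simp [dirD]
  rw [h0, add_zero, ← hτ] at hg
  have jT := hg.comp (f := T) (by rwa [hγ0])
  have jX := hg.comp (f := X) (by rwa [hγ0])
  have jV := hg.comp (f := V) (by rwa [hγ0])
  rw [hγ0, dirD_prod_prod _ z 0 0] at jT jX jV
  have j' := (jT.prodMk jX).comp (f := u') (by rwa [hγ0])
  rw [hγ0] at j'
  have hev : (fun s => u' (T (γ s), X (γ s))) =ᶠ[𝓝 0] fun s => V (γ s) := by
    have hc : Tendsto (fun s : ℝ => p + s • ξ) (𝓝 0) (𝓝 p) := by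
      have := hl.continuousAt.tendsto
      rwa [hl0] at this
    filter_upwards [hc.eventually htr] with s hs
    simpa [hφ, hγ] using hs
  obtain ⟨e1, e2⟩ := j'.unique jV hev
  rw [dirD_prod_real] at e1
  refine ⟨by linarith, fun hT0 => ?_⟩
  rw [dirD_prod_real _ _ (_ + _)] at e2
  rw [dirD_dirD hu', hT0] at e2
  have : ((0 : ℝ), dirD τ X z) = dirD τ X z • ((0 : ℝ), (1 : ℝ)) := by simp
  rw [this, map_smul, map_smul, smul_apply, ← dirD_dirD hu'] at e2
  simp only [smul_eq_mul] at e2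
  linarith

/-! ### Existence of the transformed function -/

/-- The total derivative: a derivative along the graph of `u` is a derivative in the direction of its
tangent plane. -/
theorem dirD_comp_graph {f : ℝ × ℝ × ℝ → ℝ} {u : ℝ × ℝ → ℝ} {p : ℝ × ℝ}
    (hf : ContDiffAt ℝ ∞ f (p.1, p.2, u p)) (hu : ContDiffAt ℝ ∞ u p) (h : ℝ × ℝ) :
    dirD h (fun q => f (q.1, q.2, u q)) p = dirD (h.1, h.2, dirD h u p) f (p.1, p.2, u p) := by
  have h1 : HasFDerivAt (fun q : ℝ × ℝ => (q.1, q.2, u q))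
      ((ContinuousLinearMap.fst ℝ ℝ ℝ).prod
        ((ContinuousLinearMap.snd ℝ ℝ ℝ).prod (fderiv ℝ u p))) p :=
    hasFDerivAt_fst.prodMk (hasFDerivAt_snd.prodMk
      (hu.differentiableAt (by simp)).hasFDerivAt)
  have h2 := ((hf.differentiableAt (by simp)).hasFDerivAt.comp
    (f := fun q : ℝ × ℝ => (q.1, q.2, u q)) p h1).fderiv
  have h3 : (fun q : ℝ × ℝ => f (q.1, q.2, u q)) = f ∘ fun q : ℝ × ℝ => (q.1, q.2, u q) := rfl
  rw [h3, dirD, h2]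
  rfl

/-- If the total Jacobian of `(T, X)` along the graph of `u` does not vanish at `p`, then the
graph of `u` is mapped near `p` onto the graph of a smooth function. -/
theorem exists_transforms {φ : ℝ × ℝ × ℝ → ℝ × ℝ × ℝ} {u : ℝ × ℝ → ℝ} {p : ℝ × ℝ}
    {T X V : ℝ × ℝ × ℝ → ℝ} (hφ : φ = fun z => (T z, X z, V z))
    {z : ℝ × ℝ × ℝ} (hz : z = (p.1, p.2, u p))
    (hsm : ∀ᶠ y in 𝓝 z, ContDiffAt ℝ ∞ T y ∧ ContDiffAt ℝ ∞ X y ∧ ContDiffAt ℝ ∞ V y)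
    (hu : ContDiff ℝ ∞ u)
    (hJ : dirD (1, 0, dirD (1, 0) u p) T z * dirD (0, 1, dirD (0, 1) u p) X z
      - dirD (0, 1, dirD (0, 1) u p) T z * dirD (1, 0, dirD (1, 0) u p) X z ≠ 0) :
    ∃ u' : ℝ × ℝ → ℝ, SmoothNear u' (T z, X z) ∧ Transforms φ u u' p := by
  set γ : ℝ × ℝ → ℝ × ℝ × ℝ := fun q => (q.1, q.2, u q) with hγ
  have hγs : ContDiff ℝ ∞ γ := contDiff_fst.prodMk (contDiff_snd.prodMk hu)
  have hγp : γ p = z := by rw [hz]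
  have hev : ∀ᶠ q in 𝓝 p, ContDiffAt ℝ ∞ T (γ q) ∧ ContDiffAt ℝ ∞ X (γ q) ∧
      ContDiffAt ℝ ∞ V (γ q) := by
    have := hγs.continuous.continuousAt (x := p)
    rw [ContinuousAt, hγp] at this
    exact this.eventually hsm
  set ψ : ℝ × ℝ → ℝ × ℝ := fun q => (T (γ q), X (γ q)) with hψ
  have hψs : ∀ᶠ q in 𝓝 p, ContDiffAt ℝ ∞ ψ q := by
    filter_upwards [hev] with q hq
    exact (hq.1.comp q hγs.contDiffAt).prodMk (hq.2.1.comp q hγs.contDiffAt)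
  have hup : ContDiffAt ℝ ∞ u p := hu.contDiffAt
  have hder : ∀ h, fderiv ℝ ψ p h =
      (dirD (h.1, h.2, dirD h u p) T z, dirD (h.1, h.2, dirD h u p) X z) := by
    intro h
    obtain ⟨hT, hX, -⟩ := hev.self_of_nhds
    have h1 : DifferentiableAt ℝ (fun q => T (γ q)) p :=
      (hT.comp p hγs.contDiffAt).differentiableAt (by simp)
    have h2 : DifferentiableAt ℝ (fun q => X (γ q)) p :=
      (hX.comp p hγs.contDiffAt).differentiableAt (by simp)
    have e1 := dirD_comp_graph (f := T) hT hup h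
    have e2 := dirD_comp_graph (f := X) hX hup h
    rw [← hz] at e1 e2
    rw [← e1, ← e2, (h1.hasFDerivAt.prodMk h2.hasFDerivAt).fderiv]
    rfl
  have hinj : Function.Injective (fderiv ℝ ψ p : ℝ × ℝ →ₗ[ℝ] ℝ × ℝ) := by
    rw [← LinearMap.ker_eq_bot, LinearMap.ker_eq_bot']
    rintro ⟨h₁, h₂⟩ h0
    have h0' : fderiv ℝ ψ p (h₁, h₂) = 0 := h0
    rw [hder, dirD_prod_real u p h₁ h₂, Prod.mk_eq_zero] at h0'
    rw [dirD_prod_prod T z 1 0 (dirD (1, 0) u p), dirD_prod_prod T z 0 1 (dirD (0, 1) u p),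
      dirD_prod_prod X z 1 0 (dirD (1, 0) u p), dirD_prod_prod X z 0 1 (dirD (0, 1) u p)] at hJ
    simp only [dirD_prod_prod T z h₁ h₂, dirD_prod_prod X z h₁ h₂] at h0'
    obtain ⟨e1, e2⟩ := h0'
    have k1 : h₁ = 0 := by
      refine (mul_eq_zero.1 ?_).resolve_right hJ
      linear_combination
        (0 * dirD (1, 0, 0) X z + 1 * dirD (0, 1, 0) X z + dirD (0, 1) u p * dirD (0, 0, 1) X z) * e1
        - (0 * dirD (1, 0, 0) T z + 1 * dirD (0, 1, 0) T z
            + dirD (0, 1) u p * dirD (0, 0, 1) T z) * e2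
    have k2 : h₂ = 0 := by
      refine (mul_eq_zero.1 ?_).resolve_right hJ
      linear_combination
        (1 * dirD (1, 0, 0) T z + 0 * dirD (0, 1, 0) T z + dirD (1, 0) u p * dirD (0, 0, 1) T z) * e2
        - (1 * dirD (1, 0, 0) X z + 0 * dirD (0, 1, 0) X z
            + dirD (1, 0) u p * dirD (0, 0, 1) X z) * e1
    simp [k1, k2]
  let L : (ℝ × ℝ) ≃L[ℝ] ℝ × ℝ := (LinearEquiv.ofInjectiveEndo _ hinj).toContinuousLinearEquiv
  have hL : (L : ℝ × ℝ →L[ℝ] ℝ × ℝ) = fderiv ℝ ψ p := by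
    ext <;> rfl
  have hψp := hψs.self_of_nhds
  have hLd : HasFDerivAt ψ (L : ℝ × ℝ →L[ℝ] ℝ × ℝ) p := by
    rw [hL]; exact (hψp.differentiableAt (by simp)).hasFDerivAt
  -- the derivative stays invertible near `p`, so that the local inverse is smooth near `ψ p`
  have hinv : ∀ᶠ q in 𝓝 p, ∃ M : (ℝ × ℝ) ≃L[ℝ] ℝ × ℝ,
      (M : ℝ × ℝ →L[ℝ] ℝ × ℝ) = fderiv ℝ ψ q := by
    have hc : ContinuousAt (fderiv ℝ ψ) p :=
      (hψp.fderiv_right (m := ∞) (by simp)).continuousAt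
    have := L.nhds
    rw [hL] at this
    exact hc.eventually this
  let e := hψp.toOpenPartialHomeomorph ψ hLd (by simp)
  have he : (e : ℝ × ℝ → ℝ × ℝ) = ψ := hψp.toOpenPartialHomeomorph_coe hLd (by simp)
  have hpe : p ∈ e.source := hψp.mem_toOpenPartialHomeomorph_source hLd (by simp)
  have hep : e p = (T z, X z) := by simp [he, hψ, hγp]
  refine ⟨fun y => V (γ (e.symm y)), ?_, ?_⟩
  · have hty : e.target ∈ 𝓝 (T z, X z) := by
      rw [← hep]; exact e.open_target.mem_nhds (e.map_source hpe)
    have hts : Tendsto e.symm (𝓝 (T z, X z)) (𝓝 p) := by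
      rw [← hep]; exact e.tendsto_symm hpe
    have hall : ∀ᶠ y in 𝓝 (T z, X z), ContDiffAt ℝ ∞ (fun y => V (γ (e.symm y))) y := by
      filter_upwards [hty, hts.eventually hev, hts.eventually hψs, hts.eventually hinv]
        with y hy h1 h2 ⟨M, hM⟩
      have hs : ContDiffAt ℝ ∞ e.symm y := by
        refine e.contDiffAt_symm (f₀' := M) hy ?_ ?_
        · rw [hM, he]; exact (h2.differentiableAt (by simp)).hasFDerivAt
        · rw [he]; exact h2
      exact h1.2.2.comp y (hγs.contDiffAt.comp y hs)
    exact ⟨_, hall, fun y hy => ContDiffAt.contDiffWithinAt hy⟩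
  · filter_upwards [e.open_source.mem_nhds hpe] with q hq
    have h1 : e.symm (ψ q) = q := by rw [← he]; exact e.left_inv hq
    have h2 : ((φ (q.1, q.2, u q)).1, (φ (q.1, q.2, u q)).2.1) = ψ q := by simp [hφ, hψ, hγ]
    rw [h2, h1, hφ]

/-! ### Admissibility as a condition on jets -/

section Quadratic

variable (p : ℝ × ℝ) (v a b c e : ℝ)

/-- The quadratic polynomial with value `v` and derivatives `u_t = a`, `u_x = b`, `u_xx = c`,
`u_tt = e`, `u_tx = 0` at `p`. -/
noncomputable def quadraticJet (q : ℝ × ℝ) : ℝ :=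
  v + a * (q.1 - p.1) + b * (q.2 - p.2) + c / 2 * (q.2 - p.2) ^ 2 + e / 2 * (q.1 - p.1) ^ 2

theorem quadraticJet_self : quadraticJet p v a b c e p = v := by simp [quadraticJet]

theorem contDiff_quadraticJet : ContDiff ℝ ∞ (quadraticJet p v a b c e) := by
  unfold quadraticJet; fun_prop

theorem dirD_quadraticJet (ξ : ℝ × ℝ) : dirD ξ (quadraticJet p v a b c e) =
    fun q => a * ξ.1 + b * ξ.2 + c * ξ.2 * (q.2 - p.2) + e * ξ.1 * (q.1 - p.1) := by
  funext q
  have h1 : HasFDerivAt (fun q : ℝ × ℝ => q.1 - p.1) (ContinuousLinearMap.fst ℝ ℝ ℝ) q :=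
    hasFDerivAt_fst.sub_const _
  have h2 : HasFDerivAt (fun q : ℝ × ℝ => q.2 - p.2) (ContinuousLinearMap.snd ℝ ℝ ℝ) q :=
    hasFDerivAt_snd.sub_const _
  have := (((((h1.const_mul a).const_add v).add (h2.const_mul b)).add
    ((h2.pow 2).const_mul (c / 2))).add ((h1.pow 2).const_mul (e / 2)))
  have h3 : fderiv ℝ (quadraticJet p v a b c e) q = _ := this.fderiv
  rw [dirD, h3]
  simp
  ring

theorem dirD_dirD_quadraticJet (ξ : ℝ × ℝ) :
    dirD ξ (dirD ξ (quadraticJet p v a b c e)) p = c * ξ.2 ^ 2 + e * ξ.1 ^ 2 := by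
  rw [dirD_quadraticJet]
  have h1 : HasFDerivAt (fun q : ℝ × ℝ => q.1 - p.1) (ContinuousLinearMap.fst ℝ ℝ ℝ) p :=
    hasFDerivAt_fst.sub_const _
  have h2 : HasFDerivAt (fun q : ℝ × ℝ => q.2 - p.2) (ContinuousLinearMap.snd ℝ ℝ ℝ) p :=
    hasFDerivAt_snd.sub_const _
  have := (((h2.const_mul (c * ξ.2)).const_add (a * ξ.1 + b * ξ.2)).add
    (h1.const_mul (e * ξ.1))).fderiv
  rw [dirD]
  erw [this]
  simp
  ring

end Quadratic

/-- The condition of admissibility on the level of jets: `(a, b, c, e)` are the derivatives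
`u_t, u_x, u_xx, u_tt` of a function with `u_tx = 0`, and `(p, q, r)` are the transformed
derivatives `u'_t, u'_x, u'_xx`. -/
theorem IsAdmissible.jet_condition {E E' : ImagedEquation} {φ : ℝ × ℝ × ℝ → ℝ × ℝ × ℝ}
    {Ω : Set (ℝ × ℝ × ℝ)} (hΩ : IsOpen Ω) (had : IsAdmissible E E' φ Ω)
    {T X V : ℝ × ℝ × ℝ → ℝ} (hφ : φ = fun z => (T z, X z, V z))
    (hT : ∀ z ∈ Ω, ContDiffAt ℝ ∞ T z) (hX : ∀ z ∈ Ω, ContDiffAt ℝ ∞ X z)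
    (hV : ∀ z ∈ Ω, ContDiffAt ℝ ∞ V z) {z : ℝ × ℝ × ℝ} (hz : z ∈ Ω) {a b : ℝ}
    (hJ : dirD (1, 0, a) T z * dirD (0, 1, b) X z - dirD (0, 1, b) T z * dirD (1, 0, a) X z ≠ 0)
    (c e : ℝ) :
    ∃ p q r : ℝ,
      p * dirD (1, 0, a) T z + q * dirD (1, 0, a) X z = dirD (1, 0, a) V z ∧
      p * dirD (0, 1, b) T z + q * dirD (0, 1, b) X z = dirD (0, 1, b) V z ∧
      (∀ (ξ₁ ξ₂ : ℝ) (τ : ℝ × ℝ × ℝ), τ = (ξ₁, ξ₂, a * ξ₁ + b * ξ₂) → dirD τ T z = 0 →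
        r * dirD τ X z ^ 2
          + p * (dirD τ (dirD τ T) z + (c * ξ₂ ^ 2 + e * ξ₁ ^ 2) * dirD (0, 0, 1) T z)
          + q * (dirD τ (dirD τ X) z + (c * ξ₂ ^ 2 + e * ξ₁ ^ 2) * dirD (0, 0, 1) X z)
        = dirD τ (dirD τ V) z + (c * ξ₂ ^ 2 + e * ξ₁ ^ 2) * dirD (0, 0, 1) V z) ∧
      (a = c + E.F z.2.1 * b + E.ε * Real.exp z.2.2 + E.H z.2.1 ↔
        p = r + E'.F (X z) * q + E'.ε * Real.exp (V z) + E'.H (X z)) := by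
  obtain ⟨t, x, v⟩ := z
  set u := quadraticJet (t, x) v a b c e with hu
  have hus : ContDiff ℝ ∞ u := contDiff_quadraticJet _ _ _ _ _ _
  have huv : u (t, x) = v := quadraticJet_self _ _ _ _ _ _
  have hud : ∀ ξ : ℝ × ℝ, dirD ξ u (t, x) = a * ξ.1 + b * ξ.2 := by
    intro ξ; rw [hu, dirD_quadraticJet]; simp
  have hut : dirD (1, 0) u (t, x) = a := by simp [hud]
  have hux : dirD (0, 1) u (t, x) = b := by simp [hud]
  have hudd : ∀ ξ : ℝ × ℝ, dirD ξ (dirD ξ u) (t, x) = c * ξ.2 ^ 2 + e * ξ.1 ^ 2 :=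
    dirD_dirD_quadraticJet _ _ _ _ _ _
  have hzu : (t, x, v) = ((t, x).1, (t, x).2, u (t, x)) := by rw [huv]
  have hsm : ∀ᶠ y in 𝓝 (t, x, v),
      ContDiffAt ℝ ∞ T y ∧ ContDiffAt ℝ ∞ X y ∧ ContDiffAt ℝ ∞ V y := by
    filter_upwards [hΩ.mem_nhds hz] with y hy using ⟨hT y hy, hX y hy, hV y hy⟩
  obtain ⟨u', hu', htr⟩ := exists_transforms hφ hzu hsm hus (by rwa [hut, hux])
  have hu's := hu'.contDiffAt
  have pro := fun ξ => prolongation hφ hzu (hT _ hz) (hX _ hz) (hV _ hz) hus.contDiffAt hu's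
    htr ξ rfl
  have hval : u' (T (t, x, v), X (t, x, v)) = V (t, x, v) := by
    have := htr.self_of_nhds
    simpa [hφ, huv] using this
  refine ⟨dirD (1, 0) u' (T (t, x, v), X (t, x, v)), dirD (0, 1) u' (T (t, x, v), X (t, x, v)),
    dirD (0, 1) (dirD (0, 1) u') (T (t, x, v), X (t, x, v)), ?_, ?_, ?_, ?_⟩
  · simpa [hut] using (pro (1, 0)).1
  · simpa [hux] using (pro (0, 1)).1
  · rintro ξ₁ ξ₂ τ rfl h0
    have := (pro (ξ₁, ξ₂)).2
    rw [hud, hudd] at this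
    exact this h0
  · have hc := had.connects u u' (t, x) (by rwa [huv])
      ⟨univ, univ_mem, hus.contDiffOn⟩ (by simpa [hφ, huv] using hu') htr
    have e2 : ((φ (t, x, u (t, x))).1, (φ (t, x, u (t, x))).2.1) =
      (T (t, x, v), X (t, x, v)) := by simp [hφ, huv]
    simp only [e2] at hc
    rw [E.holdsAt_iff hus.contDiffAt, E'.holdsAt_iff hu's, hut, hux, hudd, huv, hval] at hc
    simpa using hc

/-- The derivative of a map with components `T`, `X`, `V`, written with partial derivatives,
attains every value if its determinant does not vanish. -/
theorem exists_partials_eq {T X V : ℝ × ℝ × ℝ → ℝ} {z : ℝ × ℝ × ℝ}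
    (hT : ContDiffAt ℝ ∞ T z) (hX : ContDiffAt ℝ ∞ X z) (hV : ContDiffAt ℝ ∞ V z)
    (hdet : (fderiv ℝ (fun z => (T z, X z, V z)) z).det ≠ 0) (w₁ w₂ w₃ : ℝ) :
    ∃ x y w : ℝ,
      x * dirD (1, 0, 0) T z + y * dirD (0, 1, 0) T z + w * dirD (0, 0, 1) T z = w₁ ∧
      x * dirD (1, 0, 0) X z + y * dirD (0, 1, 0) X z + w * dirD (0, 0, 1) X z = w₂ ∧
      x * dirD (1, 0, 0) V z + y * dirD (0, 1, 0) V z + w * dirD (0, 0, 1) V z = w₃ := by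
  have hd := (hT.differentiableAt (by simp)).hasFDerivAt.prodMk
    ((hX.differentiableAt (by simp)).hasFDerivAt.prodMk
      (hV.differentiableAt (by simp)).hasFDerivAt)
  obtain ⟨⟨x, y, w⟩, h⟩ :=
    (ContinuousLinearMap.toContinuousLinearEquivOfDetNeZero _ hdet).surjective (w₁, w₂, w₃)
  have h' : fderiv ℝ (fun z => (T z, X z, V z)) z (x, y, w) = (w₁, w₂, w₃) := h
  rw [hd.fderiv] at h'
  have h'' : (dirD (x, y, w) T z, dirD (x, y, w) X z, dirD (x, y, w) V z) = (w₁, w₂, w₃) := h'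
  rw [dirD_prod_prod T z x y w, dirD_prod_prod X z x y w, dirD_prod_prod V z x y w] at h''
  simp only [Prod.mk.injEq] at h''
  exact ⟨x, y, w, h''⟩

/-! ### `T = T(t)` and `X_x² = T_t` -/

/-- `φ = (T, X, V)` is an admissible transformation on the open set `Ω`. Smoothness of the
components is stated once more, separately for each of them and at every point. -/
structure AdmissibleTriple (E E' : ImagedEquation) (T X V : ℝ × ℝ × ℝ → ℝ)
    (Ω : Set (ℝ × ℝ × ℝ)) : Prop where
  isOpen : IsOpen Ω
  admissible : IsAdmissible E E' (fun z => (T z, X z, V z)) Ω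
  smooth_T : ∀ z ∈ Ω, ContDiffAt ℝ ∞ T z
  smooth_X : ∀ z ∈ Ω, ContDiffAt ℝ ∞ X z
  smooth_V : ∀ z ∈ Ω, ContDiffAt ℝ ∞ V z

theorem dirD_eq_zero_of_const_on {f : ℝ × ℝ × ℝ → ℝ} {Ω : Set (ℝ × ℝ × ℝ)} (hΩ : IsOpen Ω)
    {k : ℝ} (h : ∀ y ∈ Ω, f y = k) {z : ℝ × ℝ × ℝ} (hz : z ∈ Ω) (w : ℝ × ℝ × ℝ) :
    dirD w f z = 0 := by
  refine dirD_eq_zero_of_eventually_eq (k := k) ?_ w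
  filter_upwards [hΩ.mem_nhds hz] with y hy using h y hy

namespace AdmissibleTriple

variable {E E' : ImagedEquation} {T X V : ℝ × ℝ × ℝ → ℝ} {Ω : Set (ℝ × ℝ × ℝ)} {z : ℝ × ℝ × ℝ}

theorem exists_partials_eq (h : AdmissibleTriple E E' T X V Ω) (hz : z ∈ Ω) (w₁ w₂ w₃ : ℝ) :
    ∃ x y w : ℝ,
      x * dirD (1, 0, 0) T z + y * dirD (0, 1, 0) T z + w * dirD (0, 0, 1) T z = w₁ ∧
      x * dirD (1, 0, 0) X z + y * dirD (0, 1, 0) X z + w * dirD (0, 0, 1) X z = w₂ ∧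
      x * dirD (1, 0, 0) V z + y * dirD (0, 1, 0) V z + w * dirD (0, 0, 1) V z = w₃ :=
  _root_.exists_partials_eq (h.smooth_T z hz) (h.smooth_X z hz) (h.smooth_V z hz)
    (h.admissible.point.jacobian_ne_zero z hz) w₁ w₂ w₃

/-- The covector `(p, q, -1)` that annihilates the image of the tangent plane of a graph does not
annihilate the image of the vertical direction. -/
theorem covector_ne (h : AdmissibleTriple E E' T X V Ω) (hz : z ∈ Ω) {a b p q : ℝ}
    (h1 : p * dirD (1, 0, a) T z + q * dirD (1, 0, a) X z = dirD (1, 0, a) V z)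
    (h2 : p * dirD (0, 1, b) T z + q * dirD (0, 1, b) X z = dirD (0, 1, b) V z) :
    p * dirD (0, 0, 1) T z + q * dirD (0, 0, 1) X z - dirD (0, 0, 1) V z ≠ 0 := by
  intro h3
  obtain ⟨x, y, w, e1, e2, e3⟩ := h.exists_partials_eq hz 0 0 1
  rw [dirD_prod_prod T z 1 0 a, dirD_prod_prod X z 1 0 a, dirD_prod_prod V z 1 0 a] at h1
  rw [dirD_prod_prod T z 0 1 b, dirD_prod_prod X z 0 1 b, dirD_prod_prod V z 0 1 b] at h2
  have : (1 : ℝ) = 0 := by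
    linear_combination (-1) * e3 + p * e1 + q * e2 - x * h1 - y * h2 - (w - a * x - b * y) * h3
  exact one_ne_zero this

/-- The total Jacobian of `(T, X)`, a polynomial of degree one in the derivatives `a = u_t` and
`b = u_x`, is not identically zero. -/
theorem exists_totalJacobian_ne (h : AdmissibleTriple E E' T X V Ω) (hz : z ∈ Ω) :
    ∃ a b : ℝ, dirD (1, 0, a) T z * dirD (0, 1, b) X z
      - dirD (0, 1, b) T z * dirD (1, 0, a) X z ≠ 0 := by
  by_contra! h0
  have hm : ∀ a b : ℝ, (dirD (1, 0, 0) T z + a * dirD (0, 0, 1) T z)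
      * (dirD (0, 1, 0) X z + b * dirD (0, 0, 1) X z)
      - (dirD (0, 1, 0) T z + b * dirD (0, 0, 1) T z)
      * (dirD (1, 0, 0) X z + a * dirD (0, 0, 1) X z) = 0 := by
    intro a b
    have := h0 a b
    rw [dirD_prod_prod T z 1 0 a, dirD_prod_prod X z 1 0 a, dirD_prod_prod T z 0 1 b,
      dirD_prod_prod X z 0 1 b] at this
    linear_combination this
  obtain ⟨x, y, w, e1, e2, -⟩ := h.exists_partials_eq hz 1 0 0
  obtain ⟨x', y', w', f1, f2, -⟩ := h.exists_partials_eq hz 0 1 0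
  have m0 := hm 0 0
  have m1 := hm 1 0
  have m2 := hm 0 1
  -- the Cauchy-Binet formula for the first two rows of the Jacobian matrix
  have key : (x * dirD (1, 0, 0) T z + y * dirD (0, 1, 0) T z + w * dirD (0, 0, 1) T z)
      * (x' * dirD (1, 0, 0) X z + y' * dirD (0, 1, 0) X z + w' * dirD (0, 0, 1) X z)
      - (x' * dirD (1, 0, 0) T z + y' * dirD (0, 1, 0) T z + w' * dirD (0, 0, 1) T z)
      * (x * dirD (1, 0, 0) X z + y * dirD (0, 1, 0) X z + w * dirD (0, 0, 1) X z) = 0 := by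
    linear_combination (x * y' - y * x') * m0 + (w * y' - y * w') * (m1 - m0)
      + (x * w' - w * x') * (m2 - m0)
  rw [e1, e2, f1, f2] at key
  norm_num at key

/-- Two functions that differ only in `u_tt` show that `D_x T = T_x + u_x T_v` vanishes: otherwise
`u_tt` would enter the transformed equation. -/
theorem dirD_T_eq_zero_of_ne (h : AdmissibleTriple E E' T X V Ω) (hz : z ∈ Ω) {a b : ℝ}
    (hJ : dirD (1, 0, a) T z * dirD (0, 1, b) X z
      - dirD (0, 1, b) T z * dirD (1, 0, a) X z ≠ 0) :
    dirD (0, 1, b) T z = 0 := by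
  -- with this `u_xx` both functions satisfy the first equation
  set c := a - (E.F z.2.1 * b + E.ε * Real.exp z.2.2 + E.H z.2.1) with hc
  obtain ⟨p, q, r, h1, h2, h3, h4⟩ := h.admissible.jet_condition h.isOpen rfl h.smooth_T h.smooth_X
    h.smooth_V hz hJ c 0
  obtain ⟨p', q', r', h1', h2', h3', h4'⟩ := h.admissible.jet_condition h.isOpen rfl h.smooth_T
    h.smooth_X h.smooth_V hz hJ c 1
  have h5 := h4.1 (by rw [hc]; ring)
  have h5' := h4'.1 (by rw [hc]; ring)
  have ep : p' = p := by
    refine sub_eq_zero.1 ((mul_eq_zero.1 ?_).resolve_right hJ)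
    linear_combination dirD (0, 1, b) X z * (h1' - h1) - dirD (1, 0, a) X z * (h2' - h2)
  have eq : q' = q := by
    refine sub_eq_zero.1 ((mul_eq_zero.1 ?_).resolve_right hJ)
    linear_combination dirD (1, 0, a) T z * (h2' - h2) - dirD (0, 1, b) T z * (h1' - h1)
  subst ep eq
  have er : r' = r := by linarith
  subst er
  -- the direction in which the transformed `t` does not change
  have hτ : dirD (-dirD (0, 1, b) T z, dirD (1, 0, a) T z,
      a * -dirD (0, 1, b) T z + b * dirD (1, 0, a) T z) T z = 0 := by
    rw [dirD_prod_prod T z (-dirD (0, 1, b) T z), dirD_prod_prod T z 1 0 a,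
      dirD_prod_prod T z 0 1 b]
    ring
  have k1 := h3 _ _ _ rfl hτ
  have k2 := h3' _ _ _ rfl hτ
  have hne := h.covector_ne hz h1 h2
  have : dirD (0, 1, b) T z ^ 2 = 0 := by
    refine (mul_eq_zero.1 ?_).resolve_right hne
    linear_combination k2 - k1
  exact pow_eq_zero_iff (two_ne_zero) |>.1 this

/-- `T_x + b T_v` vanishes for two values of `b`, hence `T_x = T_v = 0`. -/
theorem T_x_T_v (h : AdmissibleTriple E E' T X V Ω) (hz : z ∈ Ω) :
    dirD (0, 1, 0) T z = 0 ∧ dirD (0, 0, 1) T z = 0 := by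
  obtain ⟨a, b, hJ⟩ := h.exists_totalJacobian_ne hz
  have hb := h.dirD_T_eq_zero_of_ne hz hJ
  obtain ⟨b', hb', hJ'⟩ : ∃ b', b' ≠ b ∧ dirD (1, 0, a) T z * dirD (0, 1, b') X z
      - dirD (0, 1, b') T z * dirD (1, 0, a) X z ≠ 0 := by
    by_contra! h0
    have h1 := h0 (b + 1) (by simp)
    have h2 := h0 (b + 2) (by simp)
    rw [dirD_prod_prod X z 0 1, dirD_prod_prod T z 0 1] at h1 h2 hJ
    apply hJ
    linear_combination 2 * h1 - h2
  have hb2 := h.dirD_T_eq_zero_of_ne hz hJ'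
  rw [dirD_prod_prod T z 0 1 b] at hb
  rw [dirD_prod_prod T z 0 1 b'] at hb2
  have hv : dirD (0, 0, 1) T z = 0 := by
    refine (mul_eq_zero.1 ?_).resolve_left (sub_ne_zero.2 hb')
    linear_combination hb2 - hb
  rw [hv] at hb
  exact ⟨by linear_combination hb, hv⟩

theorem T_t_ne_zero (h : AdmissibleTriple E E' T X V Ω) (hz : z ∈ Ω) : dirD (1, 0, 0) T z ≠ 0 := by
  intro h0
  obtain ⟨x, y, w, e, -⟩ := h.exists_partials_eq hz 1 0 0
  obtain ⟨h1, h2⟩ := h.T_x_T_v hz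
  rw [h0, h1, h2] at e
  norm_num at e

theorem dirD_T (h : AdmissibleTriple E E' T X V Ω) (hz : z ∈ Ω) (b : ℝ) :
    dirD (0, 1, b) T z = 0 := by
  rw [dirD_prod_prod, (h.T_x_T_v hz).1, (h.T_x_T_v hz).2]; ring

theorem dirD_dirD_T (h : AdmissibleTriple E E' T X V Ω) (hz : z ∈ Ω) (b : ℝ) (w : ℝ × ℝ × ℝ) :
    dirD w (dirD (0, 1, b) T) z = 0 :=
  dirD_eq_zero_of_const_on h.isOpen (fun _ hy => h.dirD_T hy b) hz w

theorem totalJacobian_ne (h : AdmissibleTriple E E' T X V Ω) (hz : z ∈ Ω) {a b : ℝ}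
    (hb : dirD (0, 1, b) X z ≠ 0) :
    dirD (1, 0, a) T z * dirD (0, 1, b) X z - dirD (0, 1, b) T z * dirD (1, 0, a) X z ≠ 0 := by
  rw [h.dirD_T hz b, dirD_prod_prod T z 1 0 a, (h.T_x_T_v hz).1, (h.T_x_T_v hz).2]
  have := mul_ne_zero (h.T_t_ne_zero hz) hb
  intro h0
  apply this
  linear_combination h0

/-- Two functions that differ in `u_xx` and, as the equation demands, in `u_t` show that
`(D_x X)² = T_t`: the coefficient of `u_xx` in the equation is normalized to one. -/
theorem dirD_X_sq (h : AdmissibleTriple E E' T X V Ω) (hz : z ∈ Ω) {b : ℝ}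
    (hb : dirD (0, 1, b) X z ≠ 0) : dirD (0, 1, b) X z ^ 2 = dirD (1, 0, 0) T z := by
  set a := E.F z.2.1 * b + E.ε * Real.exp z.2.2 + E.H z.2.1 with ha
  obtain ⟨p, q, r, h1, h2, h3, h4⟩ := h.admissible.jet_condition h.isOpen rfl h.smooth_T h.smooth_X
    h.smooth_V hz (h.totalJacobian_ne hz (a := a) hb) 0 0
  obtain ⟨p', q', r', h1', h2', h3', h4'⟩ := h.admissible.jet_condition h.isOpen rfl h.smooth_T
    h.smooth_X h.smooth_V hz (h.totalJacobian_ne hz (a := a + 1) hb) 1 0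
  have h5 := h4.1 (by rw [ha]; ring)
  have h5' := h4'.1 (by rw [ha]; ring)
  have hne := h.covector_ne hz h1 h2
  have k1 := h3 0 1 (0, 1, b) (by simp) (h.dirD_T hz b)
  have k2 := h3' 0 1 (0, 1, b) (by simp) (h.dirD_T hz b)
  rw [h.dirD_dirD_T hz, (h.T_x_T_v hz).2] at k1 k2
  rw [h.dirD_T hz] at h2 h2'
  have eq : q' = q := by
    refine sub_eq_zero.1 ((mul_eq_zero.1 ?_).resolve_right hb)
    linear_combination h2' - h2
  subst eq
  rw [dirD_prod_prod T z 1 0 a, dirD_prod_prod X z 1 0 a, dirD_prod_prod V z 1 0 a,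
    (h.T_x_T_v hz).1, (h.T_x_T_v hz).2] at h1
  rw [dirD_prod_prod T z 1 0 (a + 1), dirD_prod_prod X z 1 0 (a + 1),
    dirD_prod_prod V z 1 0 (a + 1), (h.T_x_T_v hz).1, (h.T_x_T_v hz).2] at h1'
  rw [(h.T_x_T_v hz).2] at hne
  have er : r' - r = p' - p := by linarith
  have e1 : (p' - p) * dirD (1, 0, 0) T z = dirD (0, 0, 1) V z - q' * dirD (0, 0, 1) X z := by
    linear_combination h1' - h1
  have e2 : (p' - p) * dirD (0, 1, b) X z ^ 2
      = dirD (0, 0, 1) V z - q' * dirD (0, 0, 1) X z := by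
    rw [← er]
    linear_combination k2 - k1
  have hp : p' - p ≠ 0 := by
    intro h0
    rw [h0] at e1
    apply hne
    linear_combination e1
  exact mul_left_cancel₀ hp (e2.trans e1.symm)

/-- If `X_v` did not vanish, `D_x X = X_x + b X_v` would take arbitrary values, although its square
is fixed whenever it is nonzero. -/
theorem X_v_eq_zero (h : AdmissibleTriple E E' T X V Ω) (hz : z ∈ Ω) :
    dirD (0, 0, 1) X z = 0 := by
  by_contra hv
  have key : ∀ k : ℝ, k ≠ 0 → k ^ 2 = dirD (1, 0, 0) T z := by
    intro k hk
    have e : dirD (0, 1, (k - dirD (0, 1, 0) X z) / dirD (0, 0, 1) X z) X z = k := by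
      rw [dirD_prod_prod X z 0 1 (_ / _), div_mul_cancel₀ _ hv]; ring
    have := h.dirD_X_sq hz (e.symm ▸ hk)
    rwa [e] at this
  have h1 := key 1 (by norm_num)
  have h2 := key 2 (by norm_num)
  norm_num [← h1] at h2

theorem dirD_X (h : AdmissibleTriple E E' T X V Ω) (hz : z ∈ Ω) (b : ℝ) :
    dirD (0, 1, b) X z = dirD (0, 1, 0) X z := by
  rw [dirD_prod_prod X z 0 1 b, h.X_v_eq_zero hz]; ring

theorem X_x_ne_zero (h : AdmissibleTriple E E' T X V Ω) (hz : z ∈ Ω) :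
    dirD (0, 1, 0) X z ≠ 0 := by
  intro h0
  obtain ⟨a, b, hJ⟩ := h.exists_totalJacobian_ne hz
  rw [h.dirD_T hz, h.dirD_X hz b, h0] at hJ
  norm_num at hJ

theorem X_x_sq (h : AdmissibleTriple E E' T X V Ω) (hz : z ∈ Ω) :
    dirD (0, 1, 0) X z ^ 2 = dirD (1, 0, 0) T z :=
  h.dirD_X_sq hz (h.X_x_ne_zero hz)

theorem T_t_pos (h : AdmissibleTriple E E' T X V Ω) (hz : z ∈ Ω) :
    0 < dirD (1, 0, 0) T z := by
  rw [← h.X_x_sq hz]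
  have := h.X_x_ne_zero hz
  positivity

end AdmissibleTriple

/-! ### The splitting of the admissibility condition -/

/-- If an identity `A e^s + B s + C = D e^{α s + β}` holds on an interval, the exponents agree. -/
theorem exponent_eq_one {A B C D α β v : ℝ} (hA : A ≠ 0)
    (h : ∀ᶠ s in 𝓝 v, A * Real.exp s + B * s + C = D * Real.exp (α * s + β)) :
    α = 1 ∧ A * Real.exp v = D * Real.exp (α * v + β) := by
  have hE : ∀ K s : ℝ, HasDerivAt (fun s => K * Real.exp (α * s + β))
      (K * α * Real.exp (α * s + β)) s := by
    intro K s
    have h1 : HasDerivAt (fun s => α * s + β) α s := by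
      simpa using ((hasDerivAt_id s).const_mul α).add_const β
    have := (h1.exp).const_mul K
    rwa [mul_comm (Real.exp _), ← mul_assoc] at this
  have hI : ∀ s : ℝ, HasDerivAt (fun s => A * Real.exp s) (A * Real.exp s) s := fun s =>
    (Real.hasDerivAt_exp s).const_mul A
  have step : ∀ {f g f' g' : ℝ → ℝ}, (∀ s, HasDerivAt f (f' s) s) → (∀ s, HasDerivAt g (g' s) s) →
      f =ᶠ[𝓝 v] g → f' =ᶠ[𝓝 v] g' := by
    intro f g f' g' hf hg hfg
    filter_upwards [hfg.eventuallyEq_nhds] with s hs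
    exact (hf s).unique ((hg s).congr_of_eventuallyEq hs)
  have h1 : (fun s => A * Real.exp s + B) =ᶠ[𝓝 v] fun s => D * α * Real.exp (α * s + β) := by
    refine step (f := fun s => A * Real.exp s + B * s + C) (fun s => ?_) (hE D) h
    simpa using ((hI s).add ((hasDerivAt_id s).const_mul B)).add_const C
  have h2 : (fun s => A * Real.exp s) =ᶠ[𝓝 v] fun s => D * α * α * Real.exp (α * s + β) :=
    step (fun s => (hI s).add_const B) (hE (D * α)) h1
  have h3 : (fun s => A * Real.exp s) =ᶠ[𝓝 v] fun s => D * α * α * α * Real.exp (α * s + β) :=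
    step hI (hE (D * α * α)) h2
  have e2 := h2.eq_of_nhds
  have e3 := h3.eq_of_nhds
  have hne : A * Real.exp v ≠ 0 := mul_ne_zero hA (Real.exp_ne_zero v)
  have hα : α = 1 := by
    refine sub_eq_zero.1 ((mul_eq_zero.1 ?_).resolve_right hne)
    linear_combination α * e2 - e3
  refine ⟨hα, ?_⟩
  simp only [hα] at e2 ⊢
  linarith

/-- The relations that hold at a point `z` between the parameters of the equations and the
components of an admissible transformation `(T, X, V)`, together with the determining equations for
`T`, `X`, `V` themselves. They are the admissible form, written infinitesimally. -/
structure DeterminingEquations (E E' : ImagedEquation) (T X V : ℝ × ℝ × ℝ → ℝ)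
    (z : ℝ × ℝ × ℝ) : Prop where
  T_x : dirD (0, 1, 0) T z = 0
  T_v : dirD (0, 0, 1) T z = 0
  X_v : dirD (0, 0, 1) X z = 0
  T_t_pos : 0 < dirD (1, 0, 0) T z
  X_x_sq : dirD (0, 1, 0) X z ^ 2 = dirD (1, 0, 0) T z
  V_eq : V z = z.2.2 - Real.log (dirD (1, 0, 0) T z)
  F_eq : dirD (1, 0, 0) T z * E'.F (X z) = dirD (0, 1, 0) X z * E.F z.2.1 - dirD (1, 0, 0) X z
  H_eq : dirD (1, 0, 0) T z ^ 2 * E'.H (X z)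
    = dirD (1, 0, 0) T z * E.H z.2.1 - dirD (1, 0, 0) (dirD (1, 0, 0) T) z
  ε_eq : E'.ε = E.ε

theorem ImagedEquation.ε_ne_zero (E : ImagedEquation) : E.ε ≠ 0 := by
  rcases E.sign_ε with h | h <;> rw [h] <;> norm_num

theorem dirD_sq {f : ℝ × ℝ × ℝ → ℝ} {z : ℝ × ℝ × ℝ} (hf : ContDiffAt ℝ ∞ f z) (w : ℝ × ℝ × ℝ) :
    dirD w (fun y => f y ^ 2) z = 2 * f z * dirD w f z := by
  have := ((hf.differentiableAt (by simp)).hasFDerivAt.pow 2).fderiv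
  rw [dirD]
  erw [this]
  simp [dirD]

/-- A function with vanishing `v`-derivative is constant along short vertical segments. -/
theorem eventually_const_of_dirD_eq_zero {f : ℝ × ℝ × ℝ → ℝ} {Ω : Set (ℝ × ℝ × ℝ)}
    (hΩ : IsOpen Ω) (hf : ∀ y ∈ Ω, ContDiffAt ℝ ∞ f y) (h : ∀ y ∈ Ω, dirD (0, 0, 1) f y = 0)
    {t x v : ℝ} (hz : (t, x, v) ∈ Ω) : ∀ᶠ s in 𝓝 v, f (t, x, s) = f (t, x, v) := by
  have hc : Continuous fun s : ℝ => (t, x, s) := by fun_prop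
  have hO : (fun s : ℝ => (t, x, s)) ⁻¹' Ω ∈ 𝓝 v := (hΩ.preimage hc).mem_nhds hz
  obtain ⟨r, hr, hb⟩ := Metric.mem_nhds_iff.1 hO
  have hd : ∀ s ∈ Metric.ball v r, HasDerivAt (fun s => f (t, x, s)) 0 s := by
    intro s hs
    have h1 : HasDerivAt (fun s : ℝ => (t, x, s)) (0, 0, 1) s :=
      (hasDerivAt_const _ _).prodMk ((hasDerivAt_const _ _).prodMk (hasDerivAt_id s))
    have := ((hf _ (hb hs)).differentiableAt (by simp)).hasFDerivAt.comp_hasDerivAt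
      (f := fun s : ℝ => (t, x, s)) s h1
    have e : fderiv ℝ f (t, x, s) (0, 0, 1) = 0 := h _ (hb hs)
    rwa [e] at this
  filter_upwards [Metric.ball_mem_nhds v hr] with s hs
  exact Metric.isOpen_ball.is_const_of_deriv_eq_zero (convex_ball v r).isPreconnected
    (fun y hy => (hd y hy).differentiableAt.differentiableWithinAt)
    (fun y hy => (hd y hy).deriv) hs (Metric.mem_ball_self hr)

/-- A function with vanishing second `v`-derivative is affine along short vertical segments. -/
theorem eventually_affine_of_dirD_dirD_eq_zero {f : ℝ × ℝ × ℝ → ℝ} {Ω : Set (ℝ × ℝ × ℝ)}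
    (hΩ : IsOpen Ω) (hf : ∀ y ∈ Ω, ContDiffAt ℝ ∞ f y)
    (h : ∀ y ∈ Ω, dirD (0, 0, 1) (dirD (0, 0, 1) f) y = 0) {t x v : ℝ} (hz : (t, x, v) ∈ Ω) :
    ∀ᶠ s in 𝓝 v, f (t, x, s) = f (t, x, v) + (s - v) * dirD (0, 0, 1) f (t, x, v) := by
  have h1 := eventually_const_of_dirD_eq_zero hΩ (fun y hy => (hf y hy).dirD _) h hz
  have h2 := eventually_const_of_dirD_eq_zero (f := fun y => f y - y.2.2 * dirD (0, 0, 1) f y) hΩ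
    (fun y hy => (hf y hy).sub (contDiffAt_snd.snd.mul ((hf y hy).dirD _))) (fun y hy => ?_) hz
  · filter_upwards [h1, h2] with s e1 e2
    simp only [e1] at e2
    linear_combination e2
  · have hv : HasFDerivAt (fun y : ℝ × ℝ × ℝ => y.2.2)
        ((ContinuousLinearMap.snd ℝ ℝ ℝ).comp (ContinuousLinearMap.snd ℝ ℝ (ℝ × ℝ))) y :=
      ((ContinuousLinearMap.snd ℝ ℝ ℝ).comp (ContinuousLinearMap.snd ℝ ℝ (ℝ × ℝ))).hasFDerivAt
    have h3 := ((hf y hy).differentiableAt (by simp)).hasFDerivAt.sub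
      (hv.mul (((hf y hy).dirD (0, 0, 1)).differentiableAt (by simp)).hasFDerivAt)
    have e := h y hy
    rw [dirD] at e ⊢
    erw [h3.fderiv]
    simp [e, dirD]

/-- If `T` is constant in a direction `w`, then the derivative of `X` in that direction is constant
in that direction as soon as its square is `T_t`. -/
theorem dirD_dirD_eq_zero_of_sq_eq {T X : ℝ × ℝ × ℝ → ℝ} {Ω : Set (ℝ × ℝ × ℝ)}
    (hΩ : IsOpen Ω) (hT : ∀ y ∈ Ω, ContDiffAt ℝ ∞ T y) (hX : ∀ y ∈ Ω, ContDiffAt ℝ ∞ X y)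
    {w : ℝ × ℝ × ℝ} (h0 : ∀ y ∈ Ω, dirD w T y = 0)
    (hsq : ∀ y ∈ Ω, dirD w X y ^ 2 = dirD (1, 0, 0) T y) {z : ℝ × ℝ × ℝ}
    (hne : dirD w X z ≠ 0) (hz : z ∈ Ω) : dirD w (dirD w X) z = 0 := by
  have h1 : (fun y => dirD w X y ^ 2) =ᶠ[𝓝 z] dirD (1, 0, 0) T := by
    filter_upwards [hΩ.mem_nhds hz] with y hy using hsq y hy
  have h2 := (dirD_eventuallyEq h1 w).eq_of_nhds
  rw [dirD_comm (hT z hz), dirD_eq_zero_of_const_on hΩ h0 hz, dirD_sq ((hX z hz).dirD w)] at h2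
  simpa [hne] using h2

/-- The derivatives of `V = v - ln T_t`. -/
theorem dirD_of_eq_sub_log {T V : ℝ × ℝ × ℝ → ℝ} {Ω : Set (ℝ × ℝ × ℝ)} (hΩ : IsOpen Ω)
    (hV : ∀ y ∈ Ω, V y = y.2.2 - Real.log (dirD (1, 0, 0) T y)) {z : ℝ × ℝ × ℝ} (hz : z ∈ Ω)
    (hT : ContDiffAt ℝ ∞ T z) (hne : dirD (1, 0, 0) T z ≠ 0) (w : ℝ × ℝ × ℝ) :
    dirD w V z = w.2.2 - dirD w (dirD (1, 0, 0) T) z / dirD (1, 0, 0) T z := by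
  have e : V =ᶠ[𝓝 z] fun y => y.2.2 - Real.log (dirD (1, 0, 0) T y) := by
    filter_upwards [hΩ.mem_nhds hz] with y hy using hV y hy
  rw [(dirD_eventuallyEq e w).eq_of_nhds]
  have hv : HasFDerivAt (fun y : ℝ × ℝ × ℝ => y.2.2)
      ((ContinuousLinearMap.snd ℝ ℝ ℝ).comp (ContinuousLinearMap.snd ℝ ℝ (ℝ × ℝ))) z :=
    ((ContinuousLinearMap.snd ℝ ℝ ℝ).comp (ContinuousLinearMap.snd ℝ ℝ (ℝ × ℝ))).hasFDerivAt
  have h3 := (hv.sub (((hT.dirD (1, 0, 0)).differentiableAt (by simp)).hasFDerivAt.log hne)).fderiv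
  rw [dirD]
  erw [h3]
  simp [dirD]
  ring

namespace AdmissibleTriple

variable {E E' : ImagedEquation} {T X V : ℝ × ℝ × ℝ → ℝ} {Ω : Set (ℝ × ℝ × ℝ)} {z : ℝ × ℝ × ℝ}

theorem dirD_T_t (h : AdmissibleTriple E E' T X V Ω) (hz : z ∈ Ω) (b : ℝ) :
    dirD (0, 1, b) (dirD (1, 0, 0) T) z = 0 := by
  rw [dirD_comm (h.smooth_T z hz), h.dirD_dirD_T hz]

theorem dirD_v_T_t (h : AdmissibleTriple E E' T X V Ω) (hz : z ∈ Ω) :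
    dirD (0, 0, 1) (dirD (1, 0, 0) T) z = 0 := by
  rw [dirD_comm (h.smooth_T z hz)]
  exact dirD_eq_zero_of_const_on h.isOpen (fun _ hy => (h.T_x_T_v hy).2) hz _

theorem dirD_v_dirD_X (h : AdmissibleTriple E E' T X V Ω) (hz : z ∈ Ω) (w : ℝ × ℝ × ℝ) :
    dirD (0, 0, 1) (dirD w X) z = 0 := by
  rw [dirD_comm (h.smooth_X z hz)]
  exact dirD_eq_zero_of_const_on h.isOpen (fun _ hy => h.X_v_eq_zero hy) hz _

/-- `X_xx = 0`, because `X_x² = T_t` depends on `t` only. -/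
theorem dirD_dirD_X (h : AdmissibleTriple E E' T X V Ω) (hz : z ∈ Ω) (b : ℝ) :
    dirD (0, 1, b) (dirD (0, 1, b) X) z = 0 :=
  dirD_dirD_eq_zero_of_sq_eq h.isOpen h.smooth_T h.smooth_X (fun _ hy => h.dirD_T hy b)
    (fun y hy => by rw [h.dirD_X hy, h.X_x_sq hy])
    (by rw [h.dirD_X hz]; exact h.X_x_ne_zero hz) hz

/-- The admissibility condition after `T = T(t)` and `X = X(t, x)`, `X_xx = 0` are known; both
sides are polynomials in `b = u_x`. -/
theorem splitting (h : AdmissibleTriple E E' T X V Ω) (hz : z ∈ Ω) (b : ℝ) :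
    dirD (1, 0, 0) V z + (E.F z.2.1 * b + E.ε * Real.exp z.2.2 + E.H z.2.1) * dirD (0, 0, 1) V z
      - (dirD (0, 1, 0) V z + b * dirD (0, 0, 1) V z) * (dirD (1, 0, 0) X z / dirD (0, 1, 0) X z)
    = dirD (0, 1, 0) (dirD (0, 1, 0) V) z + 2 * b * dirD (0, 1, 0) (dirD (0, 0, 1) V) z
      + b ^ 2 * dirD (0, 0, 1) (dirD (0, 0, 1) V) z
      + (dirD (0, 1, 0) V z + b * dirD (0, 0, 1) V z)
        * (E'.F (X z) * dirD (1, 0, 0) T z / dirD (0, 1, 0) X z)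
      + dirD (1, 0, 0) T z * (E'.ε * Real.exp (V z) + E'.H (X z)) := by
  set a := E.F z.2.1 * b + E.ε * Real.exp z.2.2 + E.H z.2.1 with ha
  have hx := h.X_x_ne_zero hz
  obtain ⟨p, q, r, h1, h2, h3, h4⟩ := h.admissible.jet_condition h.isOpen rfl h.smooth_T h.smooth_X
    h.smooth_V hz (h.totalJacobian_ne hz (a := a) (b := b) (by rwa [h.dirD_X hz b])) 0 0
  have h5 := h4.1 (by rw [ha]; ring)
  have k := h3 0 1 (0, 1, b) (by simp) (h.dirD_T hz b)
  rw [h.dirD_dirD_T hz, h.dirD_dirD_X hz, h.dirD_X hz b, h.X_x_sq hz] at k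
  rw [h.dirD_T hz, h.dirD_X hz b, dirD_prod_prod V z 0 1 b] at h2
  rw [dirD_prod_prod T z 1 0 a, dirD_prod_prod X z 1 0 a, dirD_prod_prod V z 1 0 a,
    (h.T_x_T_v hz).1, (h.T_x_T_v hz).2, h.X_v_eq_zero hz] at h1
  have hτ : ((0, 1, b) : ℝ × ℝ × ℝ) = (0, 1, 0) + b • (0, 0, 1) := by simp
  have hQ : dirD (0, 1, b) (dirD (0, 1, b) V) z = dirD (0, 1, 0) (dirD (0, 1, 0) V) z
      + 2 * b * dirD (0, 1, 0) (dirD (0, 0, 1) V) z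
      + b ^ 2 * dirD (0, 0, 1) (dirD (0, 0, 1) V) z := by
    have hs := dirD_comm (h.smooth_V z hz) (0, 1, 0) (0, 0, 1)
    simp only [dirD_dirD (h.smooth_V z hz)] at hs ⊢
    rw [hτ]
    simp only [map_add, map_smul, add_apply, smul_apply, smul_eq_mul]
    rw [hs]
    ring
  rw [hQ] at k
  have hq : dirD (0, 1, 0) V z + b * dirD (0, 0, 1) V z = q * dirD (0, 1, 0) X z := by
    linear_combination -h2
  rw [hq]
  have e1 : q * dirD (0, 1, 0) X z * (dirD (1, 0, 0) X z / dirD (0, 1, 0) X z)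
      = q * dirD (1, 0, 0) X z := by field_simp
  have e2 : q * dirD (0, 1, 0) X z * (E'.F (X z) * dirD (1, 0, 0) T z / dirD (0, 1, 0) X z)
      = q * (E'.F (X z) * dirD (1, 0, 0) T z) := by field_simp
  rw [e1, e2]
  linear_combination k - h1 + dirD (1, 0, 0) T z * h5

/-- The part of the splitting quadratic in `u_x`. -/
theorem V_vv (h : AdmissibleTriple E E' T X V Ω) (hz : z ∈ Ω) :
    dirD (0, 0, 1) (dirD (0, 0, 1) V) z = 0 := by
  have h0 := h.splitting hz 0
  have h1 := h.splitting hz 1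
  have h2 := h.splitting hz (-1)
  linear_combination h0 - (h1 + h2) / 2

/-- The part of the splitting linear in `u_x`. -/
theorem splitting_linear (h : AdmissibleTriple E E' T X V Ω) (hz : z ∈ Ω) :
    E.F z.2.1 * dirD (0, 0, 1) V z
      - dirD (0, 0, 1) V z * (dirD (1, 0, 0) X z / dirD (0, 1, 0) X z)
    = 2 * dirD (0, 1, 0) (dirD (0, 0, 1) V) z
      + dirD (0, 0, 1) V z * (E'.F (X z) * dirD (1, 0, 0) T z / dirD (0, 1, 0) X z) := by
  have h1 := h.splitting hz 1
  have h2 := h.splitting hz (-1)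
  linear_combination (h1 - h2) / 2

theorem V_v_ne_zero (h : AdmissibleTriple E E' T X V Ω) (hz : z ∈ Ω) :
    dirD (0, 0, 1) V z ≠ 0 := by
  intro h0
  obtain ⟨x, y, w, e1, e2, e3⟩ := h.exists_partials_eq hz 0 0 1
  rw [(h.T_x_T_v hz).1, (h.T_x_T_v hz).2] at e1
  have hx : x = 0 := by simpa [h.T_t_ne_zero hz] using e1
  rw [hx, h.X_v_eq_zero hz] at e2
  have hy : y = 0 := by simpa [h.X_x_ne_zero hz] using e2
  rw [hx, hy, h0] at e3
  norm_num at e3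

/-- Along a vertical line all the terms of the splitting but the exponentials are affine in `v`,
so that the exponentials have to match. -/
theorem V_v_eq_one (h : AdmissibleTriple E E' T X V Ω) (hz : z ∈ Ω) :
    dirD (0, 0, 1) V z = 1 ∧
      E.ε * Real.exp z.2.2 = dirD (1, 0, 0) T z * E'.ε * Real.exp (V z) := by
  obtain ⟨t, x, v⟩ := z
  -- `V_vv = 0` on an open set, so `V` and all its derivatives are affine in `v`
  have hvv : ∀ w w' : ℝ × ℝ × ℝ, ∀ y ∈ Ω,
      dirD (0, 0, 1) (dirD (0, 0, 1) (dirD w (dirD w' V))) y = 0 := by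
    intro w w' y hy
    have e : dirD (0, 0, 1) (dirD w (dirD w' V)) =ᶠ[𝓝 y] dirD w (dirD w' (dirD (0, 0, 1) V)) := by
      have e0 : ∀ y ∈ Ω, dirD (0, 0, 1) (dirD w' V) y = dirD w' (dirD (0, 0, 1) V) y :=
        fun y hy => dirD_comm (h.smooth_V y hy) _ _
      filter_upwards [h.isOpen.mem_nhds hy] with y hy
      rw [dirD_comm ((h.smooth_V y hy).dirD w')]
      refine (dirD_eventuallyEq ?_ w).eq_of_nhds
      filter_upwards [h.isOpen.mem_nhds hy] with y hy using e0 y hy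
    rw [(dirD_eventuallyEq e _).eq_of_nhds]
    have hs := (h.smooth_V y hy).dirD (0, 0, 1)
    rw [dirD_comm (hs.dirD w')]
    refine dirD_eq_zero_of_const_on (k := 0) h.isOpen (fun y hy => ?_) hy w
    rw [dirD_comm ((h.smooth_V y hy).dirD (0, 0, 1))]
    exact dirD_eq_zero_of_const_on (k := 0) h.isOpen (fun y hy => h.V_vv hy) hy w'
  have hvv1 : ∀ w : ℝ × ℝ × ℝ, ∀ y ∈ Ω, dirD (0, 0, 1) (dirD (0, 0, 1) (dirD w V)) y = 0 := by
    intro w y hy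
    have e : dirD (0, 0, 1) (dirD w V) =ᶠ[𝓝 y] dirD w (dirD (0, 0, 1) V) := by
      filter_upwards [h.isOpen.mem_nhds hy] with y hy using dirD_comm (h.smooth_V y hy) _ _
    rw [(dirD_eventuallyEq e _).eq_of_nhds, dirD_comm ((h.smooth_V y hy).dirD _)]
    exact dirD_eq_zero_of_const_on (k := 0) h.isOpen (fun y hy => h.V_vv hy) hy w
  have aff := @eventually_affine_of_dirD_dirD_eq_zero
  have V0 := aff h.isOpen h.smooth_V (fun y hy => h.V_vv hy) hz
  have V1 := aff h.isOpen (fun y hy => (h.smooth_V y hy).dirD _) (hvv1 (1, 0, 0)) hz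
  have V2 := aff h.isOpen (fun y hy => (h.smooth_V y hy).dirD _) (hvv1 (0, 1, 0)) hz
  have V3 := aff h.isOpen (fun y hy => ((h.smooth_V y hy).dirD _).dirD _)
    (hvv (0, 1, 0) (0, 1, 0)) hz
  have cst := @eventually_const_of_dirD_eq_zero
  have C0 := cst h.isOpen (fun y hy => (h.smooth_V y hy).dirD _) (fun y hy => h.V_vv hy) hz
  have C1 := cst h.isOpen h.smooth_X (fun y hy => h.X_v_eq_zero hy) hz
  have C2 := cst h.isOpen (fun y hy => (h.smooth_X y hy).dirD _)
    (fun y hy => h.dirD_v_dirD_X hy (1, 0, 0)) hz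
  have C3 := cst h.isOpen (fun y hy => (h.smooth_X y hy).dirD _)
    (fun y hy => h.dirD_v_dirD_X hy (0, 1, 0)) hz
  have C4 := cst h.isOpen (fun y hy => (h.smooth_T y hy).dirD _)
    (fun y hy => h.dirD_v_T_t hy) hz
  have hO : ∀ᶠ s in 𝓝 v, (t, x, s) ∈ Ω := by
    have hc : ContinuousAt (fun s : ℝ => (t, x, s)) v := by fun_prop
    exact hc.eventually (h.isOpen.mem_nhds hz)
  obtain ⟨α, hα⟩ : ∃ α, α = dirD (0, 0, 1) V (t, x, v) := ⟨_, rfl⟩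
  have hα0 : α ≠ 0 := hα ▸ h.V_v_ne_zero hz
  set z : ℝ × ℝ × ℝ := (t, x, v) with hzdef
  set k := dirD (1, 0, 0) X z / dirD (0, 1, 0) X z with hk
  set m := E'.F (X z) * dirD (1, 0, 0) T z / dirD (0, 1, 0) X z with hm
  have key : ∀ᶠ s in 𝓝 v, E.ε * α * Real.exp s
      + (dirD (0, 0, 1) (dirD (1, 0, 0) V) z
          - dirD (0, 0, 1) (dirD (0, 1, 0) V) z * (k + m)
          - dirD (0, 0, 1) (dirD (0, 1, 0) (dirD (0, 1, 0) V)) z) * s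
      + (dirD (1, 0, 0) V z - v * dirD (0, 0, 1) (dirD (1, 0, 0) V) z + E.H x * α
          - (dirD (0, 1, 0) V z - v * dirD (0, 0, 1) (dirD (0, 1, 0) V) z) * (k + m)
          - (dirD (0, 1, 0) (dirD (0, 1, 0) V) z
            - v * dirD (0, 0, 1) (dirD (0, 1, 0) (dirD (0, 1, 0) V)) z)
          - dirD (1, 0, 0) T z * E'.H (X z))
      = dirD (1, 0, 0) T z * E'.ε * Real.exp (α * s + (V z - v * α)) := by
    filter_upwards [hO, V0, V1, V2, V3, C0, C1, C2, C3, C4] with s hs v0 v1 v2 v3 c0 c1 c2 c3 c4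
    have sp := h.splitting hs 0
    simp only [v1, v2, v3, c0, c1, c2, c3, c4] at sp
    rw [v0, ← hα] at sp
    have : V z + (s - v) * α = α * s + (V z - v * α) := by ring
    rw [this] at sp
    rw [hk, hm]
    linear_combination sp
  obtain ⟨h1, h2⟩ := exponent_eq_one (mul_ne_zero E.ε_ne_zero hα0) key
  refine ⟨hα ▸ h1, ?_⟩
  rw [h1] at h2
  have : 1 * v + (V z - v * 1) = V z := by ring
  rw [this] at h2
  simpa using h2

theorem determiningEquations (h : AdmissibleTriple E E' T X V Ω) (hz : z ∈ Ω) :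
    DeterminingEquations E E' T X V z := by
  have hpos : ∀ y ∈ Ω, 0 < dirD (1, 0, 0) T y := fun y hy => h.T_t_pos hy
  have hε : ∀ y ∈ Ω, E'.ε = E.ε ∧ Real.exp y.2.2 = dirD (1, 0, 0) T y * Real.exp (V y) := by
    intro y hy
    have h1 := (h.V_v_eq_one hy).2
    have h2 : 0 < dirD (1, 0, 0) T y * Real.exp (V y) := mul_pos (hpos y hy) (Real.exp_pos _)
    have h3 := Real.exp_pos y.2.2
    -- both exponentials and `T_t` are positive, so the signs agree
    rcases E.sign_ε with e | e <;> rcases E'.sign_ε with e' | e' <;> rw [e, e'] at h1 ⊢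
    · exact ⟨rfl, by linarith⟩
    · exfalso; linarith
    · exfalso; linarith
    · exact ⟨rfl, by linarith⟩
  have hV : ∀ y ∈ Ω, V y = y.2.2 - Real.log (dirD (1, 0, 0) T y) := by
    intro y hy
    have := congrArg Real.log (hε y hy).2
    rw [Real.log_mul (hpos y hy).ne' (Real.exp_ne_zero _), Real.log_exp, Real.log_exp] at this
    linarith
  have hdV : ∀ w : ℝ × ℝ × ℝ, ∀ y ∈ Ω, dirD w V y
      = w.2.2 - dirD w (dirD (1, 0, 0) T) y / dirD (1, 0, 0) T y := fun w y hy =>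
    dirD_of_eq_sub_log h.isOpen hV hy (h.smooth_T y hy) (hpos y hy).ne' w
  have hVv : ∀ y ∈ Ω, dirD (0, 0, 1) V y = 1 := fun y hy => (h.V_v_eq_one hy).1
  have hVx : ∀ y ∈ Ω, dirD (0, 1, 0) V y = 0 := by
    intro y hy
    rw [hdV _ y hy, h.dirD_T_t hy]; simp
  have hVt : dirD (1, 0, 0) V z = -(dirD (1, 0, 0) (dirD (1, 0, 0) T) z / dirD (1, 0, 0) T z) := by
    rw [hdV _ z hz]; simp
  have hX := h.X_x_ne_zero hz
  have hT := (hpos z hz).ne'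
  refine ⟨(h.T_x_T_v hz).1, (h.T_x_T_v hz).2, h.X_v_eq_zero hz, hpos z hz, h.X_x_sq hz, hV z hz,
    ?_, ?_, (hε z hz).1⟩
  · have := h.splitting_linear hz
    rw [hVv z hz, dirD_eq_zero_of_const_on h.isOpen hVv hz] at this
    field_simp at this
    linear_combination -this
  · have := h.splitting hz 0
    rw [hVv z hz, hVx z hz, dirD_eq_zero_of_const_on h.isOpen hVx hz, hVt, (hε z hz).1,
      (hε z hz).2] at this
    simp only [mul_zero, zero_mul, zero_add, add_zero, mul_one, sub_zero, ne_eq, OfNat.ofNat_ne_zero,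
      not_false_eq_true, zero_pow] at this
    field_simp at this
    linear_combination -this

end AdmissibleTriple

/-! ### Sufficiency of the determining equations -/

section Sufficiency

variable {E E' : ImagedEquation} {T X V : ℝ × ℝ × ℝ → ℝ} {Ω : Set (ℝ × ℝ × ℝ)}

theorem DeterminingEquations.X_x_ne_zero {z : ℝ × ℝ × ℝ}
    (h : DeterminingEquations E E' T X V z) : dirD (0, 1, 0) X z ≠ 0 := by
  intro h0
  have := h.T_t_pos
  rw [← h.X_x_sq, h0] at this
  norm_num at this

/-- Under the determining equations the left-hand side minus the right-hand side of the first
equation is `T_t` times that of the second one, for every function `u`. -/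
theorem isAdmissible_of_determiningEquations (hΩ : IsOpen Ω)
    (hT : ∀ z ∈ Ω, ContDiffAt ℝ ∞ T z) (hX : ∀ z ∈ Ω, ContDiffAt ℝ ∞ X z)
    (hV : ∀ z ∈ Ω, ContDiffAt ℝ ∞ V z) (h : ∀ z ∈ Ω, DeterminingEquations E E' T X V z) :
    IsAdmissible E E' (fun z => (T z, X z, V z)) Ω := by
  have hT0 : ∀ b, ∀ z ∈ Ω, dirD (0, 1, b) T z = 0 := by
    intro b z hz
    rw [dirD_prod_prod, (h z hz).T_x, (h z hz).T_v]; ring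
  have hX0 : ∀ b, ∀ z ∈ Ω, dirD (0, 1, b) X z = dirD (0, 1, 0) X z := by
    intro b z hz
    rw [dirD_prod_prod X z 0 1 b, (h z hz).X_v]; ring
  have hTt : ∀ b, ∀ z ∈ Ω, dirD (0, 1, b) (dirD (1, 0, 0) T) z = 0 := by
    intro b z hz
    rw [dirD_comm (hT z hz), dirD_eq_zero_of_const_on hΩ (hT0 b) hz]
  have hTv : ∀ z ∈ Ω, dirD (0, 0, 1) (dirD (1, 0, 0) T) z = 0 := by
    intro z hz
    rw [dirD_comm (hT z hz), dirD_eq_zero_of_const_on hΩ (fun y hy => (h y hy).T_v) hz]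
  have hdV : ∀ w : ℝ × ℝ × ℝ, ∀ y ∈ Ω, dirD w V y
      = w.2.2 - dirD w (dirD (1, 0, 0) T) y / dirD (1, 0, 0) T y := fun w y hy =>
    dirD_of_eq_sub_log hΩ (fun y hy => (h y hy).V_eq) hy (hT y hy) (h y hy).T_t_pos.ne' w
  have hVv : ∀ z ∈ Ω, dirD (0, 0, 1) V z = 1 := by
    intro z hz
    rw [hdV _ z hz, hTv z hz]; simp
  have hV0 : ∀ b, ∀ z ∈ Ω, dirD (0, 1, b) V z = b := by
    intro b z hz
    rw [hdV _ z hz, hTt b z hz]; simp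
  refine ⟨⟨fun z hz => ((hT z hz).prodMk ((hX z hz).prodMk (hV z hz))).contDiffWithinAt,
    fun z hz hdet => ?_⟩, ?_⟩
  · have hd := (((hT z hz).differentiableAt (by simp)).hasFDerivAt.prodMk
      (((hX z hz).differentiableAt (by simp)).hasFDerivAt.prodMk
        ((hV z hz).differentiableAt (by simp)).hasFDerivAt)).fderiv
    obtain ⟨⟨x, y, w⟩, hk, hne⟩ :=
      Submodule.exists_mem_ne_zero_of_ne_bot (LinearMap.bot_lt_ker_of_det_eq_zero hdet).ne'
    have hk' : fderiv ℝ (fun z => (T z, X z, V z)) z (x, y, w) = 0 := hk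
    rw [hd] at hk'
    have hk2 : (dirD (x, y, w) T z, dirD (x, y, w) X z, dirD (x, y, w) V z) = (0, 0, 0) := hk'
    rw [dirD_prod_prod T z x y w, dirD_prod_prod X z x y w, dirD_prod_prod V z x y w,
      (h z hz).T_x, (h z hz).T_v, (h z hz).X_v, hVv z hz] at hk2
    simp only [Prod.mk.injEq] at hk2
    obtain ⟨e1, e2, e3⟩ := hk2
    have hx : x = 0 := by simpa [(h z hz).T_t_pos.ne'] using e1
    rw [hx] at e2 e3
    have hy : y = 0 := by simpa [(h z hz).X_x_ne_zero] using e2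
    rw [hy] at e3
    have hw : w = 0 := by simpa using e3
    exact hne (by simp [hx, hy, hw])
  · intro u u' p hp hu hu' htr
    have hus := hu.contDiffAt
    have hu's := hu'.contDiffAt
    have hval := htr.self_of_nhds
    have pro := fun ξ => prolongation rfl rfl (hT _ hp) (hX _ hp) (hV _ hp) hus hu's htr ξ rfl
    have p1 := (pro (1, 0)).1
    have p2 := (pro (0, 1)).1
    have p3 := (pro (0, 1)).2
    rw [E.holdsAt_iff hus, E'.holdsAt_iff hu's]
    simp only at hval hu's p1 p2 p3 ⊢
    rw [hval]
    set z : ℝ × ℝ × ℝ := (p.1, p.2, u p) with hz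
    have D := h z hp
    set b := dirD (0, 1) u p with hb
    set a := dirD (1, 0) u p with ha
    have q3 := p3 (hT0 b z hp)
    rw [hT0 b z hp, hX0 b z hp, hV0 b z hp] at p2
    rw [dirD_eq_zero_of_const_on hΩ (hT0 b) hp, dirD_eq_zero_of_const_on hΩ (hV0 b) hp,
      dirD_dirD_eq_zero_of_sq_eq hΩ hT hX (hT0 b) (fun y hy => by rw [hX0 b y hy, (h y hy).X_x_sq])
        (by rw [hX0 b z hp]; exact D.X_x_ne_zero) hp,
      D.T_v, D.X_v, hVv z hp, hX0 b z hp, D.X_x_sq] at q3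
    rw [dirD_prod_prod T z 1 0 a, dirD_prod_prod X z 1 0 a, dirD_prod_prod V z 1 0 a,
      D.T_x, D.T_v, D.X_v, hVv z hp, hdV (1, 0, 0) z hp] at p1
    have hexp : Real.exp (u p) = dirD (1, 0, 0) T z * Real.exp (V z) := by
      rw [D.V_eq, Real.exp_sub, Real.exp_log D.T_t_pos, mul_div_cancel₀ _ D.T_t_pos.ne']
    have hH : dirD (1, 0, 0) T z * E'.H (X z)
        = E.H z.2.1 - dirD (1, 0, 0) (dirD (1, 0, 0) T) z / dirD (1, 0, 0) T z := by
      have := D.H_eq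
      have hne := D.T_t_pos.ne'
      field_simp
      linear_combination this
    have hF := D.F_eq
    have hz2 : z.2.1 = p.2 := rfl
    rw [hz2] at hF hH
    rw [D.ε_eq, hexp, ← sub_eq_zero, ← sub_eq_zero (a := dirD (1, 0) u' (T z, X z))]
    set P := dirD (1, 0) u' (T z, X z)
    set Q := dirD (0, 1) u' (T z, X z)
    set R := dirD (0, 1) (dirD (0, 1) u') (T z, X z)
    have key : a - (dirD (0, 1) (dirD (0, 1) u) p + E.F p.2 * b
          + E.ε * (dirD (1, 0, 0) T z * Real.exp (V z)) + E.H p.2)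
        = dirD (1, 0, 0) T z * (P - (R + E'.F (X z) * Q + E.ε * Real.exp (V z) + E'.H (X z))) := by
      simp only at p1
      linear_combination -p1 + q3 + E.F p.2 * p2 + Q * hF + hH
    rw [key, mul_eq_zero, or_iff_right D.T_t_pos.ne']

end Sufficiency

/-! ### Integration of the determining equations -/

theorem ContDiffAt.deriv_top {f : ℝ → ℝ} {t : ℝ} (hf : ContDiffAt ℝ ∞ f t) :
    ContDiffAt ℝ ∞ (deriv f) t :=
  hf.dirD 1

/-- The derivatives of the function `g(t) x + k(t)`. -/
theorem dirD_affine {f : ℝ × ℝ × ℝ → ℝ} {W : Set (ℝ × ℝ × ℝ)} (hW : IsOpen W) {g k : ℝ → ℝ}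
    (hf : ∀ y ∈ W, f y = g y.1 * y.2.1 + k y.1) {z : ℝ × ℝ × ℝ} (hz : z ∈ W) {g' k' : ℝ}
    (hg : HasDerivAt g g' z.1) (hk : HasDerivAt k k' z.1) (w : ℝ × ℝ × ℝ) :
    dirD w f z = w.1 * (g' * z.2.1 + k') + w.2.1 * g z.1 := by
  have e : f =ᶠ[𝓝 z] fun y => g y.1 * y.2.1 + k y.1 := by
    filter_upwards [hW.mem_nhds hz] with y hy using hf y hy
  rw [(dirD_eventuallyEq e w).eq_of_nhds]
  have h1 : HasFDerivAt (fun y : ℝ × ℝ × ℝ => y.1) (ContinuousLinearMap.fst ℝ ℝ (ℝ × ℝ)) z :=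
    hasFDerivAt_fst
  have h2 : HasFDerivAt (fun y : ℝ × ℝ × ℝ => y.2.1)
      ((ContinuousLinearMap.fst ℝ ℝ ℝ).comp (ContinuousLinearMap.snd ℝ ℝ (ℝ × ℝ))) z :=
    ((ContinuousLinearMap.fst ℝ ℝ ℝ).comp (ContinuousLinearMap.snd ℝ ℝ (ℝ × ℝ))).hasFDerivAt
  have := ((((hg.comp_hasFDerivAt z h1).mul h2).add (hk.comp_hasFDerivAt z h1))).fderiv
  rw [dirD]
  erw [this]
  simp
  ring

/-- The derivatives of `T = τ(t)` and `X = δ √τ' x + χ(t)`. -/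
theorem partials_of_form {T X : ℝ × ℝ × ℝ → ℝ} {W : Set (ℝ × ℝ × ℝ)} (hW : IsOpen W) {δ : ℝ}
    {τ χ : ℝ → ℝ} (hτ : ContDiffOn ℝ ∞ τ (Prod.fst '' W)) (hχ : ContDiffOn ℝ ∞ χ (Prod.fst '' W))
    (hpos : ∀ t ∈ Prod.fst '' W, 0 < deriv τ t) (hT : ∀ z ∈ W, T z = τ z.1)
    (hX : ∀ z ∈ W, X z = δ * √(deriv τ z.1) * z.2.1 + χ z.1) {z : ℝ × ℝ × ℝ} (hz : z ∈ W) :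
    (∀ w, dirD w T z = w.1 * deriv τ z.1) ∧
    dirD (1, 0, 0) (dirD (1, 0, 0) T) z = deriv (deriv τ) z.1 ∧
    (∀ w, dirD w X z = w.1 * (δ * (deriv (deriv τ) z.1 / (2 * √(deriv τ z.1))) * z.2.1
      + deriv χ z.1) + w.2.1 * (δ * √(deriv τ z.1))) := by
  have hO : IsOpen (Prod.fst '' W) := isOpenMap_fst W hW
  have hτs : ∀ y ∈ W, ContDiffAt ℝ ∞ τ y.1 := fun y hy =>
    hτ.contDiffAt (hO.mem_nhds (mem_image_of_mem _ hy))
  have hχs : ContDiffAt ℝ ∞ χ z.1 := hχ.contDiffAt (hO.mem_nhds (mem_image_of_mem _ hz))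
  have hτ' : ∀ y ∈ W, DifferentiableAt ℝ (deriv τ) y.1 := fun y hy =>
    (hτs y hy).deriv_top.differentiableAt (by simp)
  have hT1 : ∀ y ∈ W, ∀ w, dirD w T y = w.1 * deriv τ y.1 := by
    intro y hy w
    rw [dirD_affine (g := fun _ => 0) (k := τ) hW (fun y hy => by simp [hT y hy]) hy
      (hasDerivAt_const _ _) ((hτs y hy).differentiableAt (by simp)).hasDerivAt w]
    ring
  refine ⟨hT1 z hz, ?_, fun w => ?_⟩
  · rw [dirD_affine (g := fun _ => 0) (k := deriv τ) hW
      (fun y hy => by rw [hT1 y hy]; ring) hz (hasDerivAt_const _ _) (hτ' z hz).hasDerivAt]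
    ring
  · refine dirD_affine (g := fun t => δ * √(deriv τ t)) hW hX hz ?_
      (hχs.differentiableAt (by simp)).hasDerivAt w
    exact ((hτ' z hz).hasDerivAt.sqrt (hpos _ (mem_image_of_mem _ hz)).ne').const_mul δ

theorem sqrt_pow_three {a : ℝ} (ha : 0 ≤ a) : √(a ^ 3) = √a ^ 3 := by
  rw [Real.sqrt_eq_iff_mul_self_eq (by positivity) (by positivity)]
  calc a ^ 3 = (√a ^ 2) ^ 3 := by rw [Real.sq_sqrt ha]
    _ = _ := by ring

/-- The determining equations are read off the admissible form. -/
theorem determiningEquations_of_form {E E' : ImagedEquation} {T X V : ℝ × ℝ × ℝ → ℝ}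
    {W : Set (ℝ × ℝ × ℝ)} (hW : IsOpen W)
    (h : HasAdmissibleForm E E' (fun z => (T z, X z, V z)) W) :
    (∀ z ∈ W, ContDiffAt ℝ ∞ T z ∧ ContDiffAt ℝ ∞ X z ∧ ContDiffAt ℝ ∞ V z) ∧
      ∀ z ∈ W, DeterminingEquations E E' T X V z := by
  obtain ⟨δ, τ, χ, hδ, hτ, hχ, hpos, hform, hε⟩ := h
  have hO : IsOpen (Prod.fst '' W) := isOpenMap_fst W hW
  have hT : ∀ z ∈ W, T z = τ z.1 := fun z hz => congrArg Prod.fst (hform _ _ _ hz).1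
  have hX : ∀ z ∈ W, X z = δ * √(deriv τ z.1) * z.2.1 + χ z.1 := fun z hz =>
    congrArg (fun y => y.2.1) (hform _ _ _ hz).1
  have hV : ∀ z ∈ W, V z = z.2.2 - Real.log (deriv τ z.1) := fun z hz =>
    congrArg (fun y => y.2.2) (hform _ _ _ hz).1
  have hδ2 : δ ^ 2 = 1 := by rcases hδ with rfl | rfl <;> norm_num
  constructor
  · intro z hz
    have hmem := mem_image_of_mem Prod.fst hz
    have c1 : ContDiffAt ℝ ∞ (fun y : ℝ × ℝ × ℝ => τ y.1) z :=
      (hτ.contDiffAt (hO.mem_nhds hmem)).comp z contDiffAt_fst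
    have c2 : ContDiffAt ℝ ∞ (fun y : ℝ × ℝ × ℝ => χ y.1) z :=
      (hχ.contDiffAt (hO.mem_nhds hmem)).comp z contDiffAt_fst
    have c3 : ContDiffAt ℝ ∞ (fun y : ℝ × ℝ × ℝ => deriv τ y.1) z :=
      (hτ.contDiffAt (hO.mem_nhds hmem)).deriv_top.comp z contDiffAt_fst
    have hne := (hpos _ hmem).ne'
    refine ⟨c1.congr_of_eventuallyEq ?_,
      ((((contDiffAt_const (c := δ)).mul (c3.sqrt hne)).mul contDiffAt_snd.fst).add
        c2).congr_of_eventuallyEq ?_,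
      (contDiffAt_snd.snd.sub (c3.log hne)).congr_of_eventuallyEq ?_⟩
    · filter_upwards [hW.mem_nhds hz] with y hy using hT y hy
    · filter_upwards [hW.mem_nhds hz] with y hy using hX y hy
    · filter_upwards [hW.mem_nhds hz] with y hy using hV y hy
  · intro z hz
    obtain ⟨d1, d2, d3⟩ := partials_of_form hW hτ hχ hpos hT hX hz
    have hp := hpos _ (mem_image_of_mem Prod.fst hz)
    obtain ⟨-, hF, hH⟩ := hform z.1 z.2.1 z.2.2 hz
    rw [← hX z hz] at hF hH
    have d4 : dirD (1, 0, 0) T z = deriv τ z.1 := by simpa using d1 (1, 0, 0)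
    have d5 : dirD (0, 1, 0) X z = δ * √(deriv τ z.1) := by simpa using d3 (0, 1, 0)
    have hsq := Real.sq_sqrt hp.le
    have hs := Real.sqrt_pos.2 hp
    refine ⟨by simp [d1], by simp [d1], by simp [d3], by rwa [d4], ?_, by rw [d4, hV z hz], ?_, ?_,
      hε⟩
    · rw [d5, d4, mul_pow, hsq, hδ2, one_mul]
    · rw [d5, d4, d3, hF, sqrt_pow_three hp.le]
      generalize √(deriv τ z.1) = s at *
      rw [← hsq]
      field_simp
      ring
    · rw [d4, d2, hH]
      field_simp

/-- A function whose `x`- and `v`-derivatives vanish is a function of `t` if the sections by the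
planes `t = const` are connected. -/
theorem exists_eq_comp_fst {f : ℝ × ℝ × ℝ → ℝ} {W : Set (ℝ × ℝ × ℝ)} (hW : IsOpen W)
    (hsec : ∀ t : ℝ, IsPreconnected {z | z ∈ W ∧ z.1 = t})
    (hf : ∀ z ∈ W, ContDiffAt ℝ ∞ f z) (hx : ∀ z ∈ W, dirD (0, 1, 0) f z = 0)
    (hv : ∀ z ∈ W, dirD (0, 0, 1) f z = 0) :
    ∃ g : ℝ → ℝ, ContDiffOn ℝ ∞ g (Prod.fst '' W) ∧ ∀ z ∈ W, f z = g z.1 := by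
  have hconst : ∀ t, ∀ y ∈ W, ∀ y' ∈ W, y.1 = t → y'.1 = t → f y = f y' := by
    rintro t ⟨t₁, q⟩ hy ⟨t₂, q'⟩ hy' rfl ht
    obtain rfl : t₂ = t₁ := ht
    set S : Set (ℝ × ℝ) := {q | (t₂, q) ∈ W} with hS
    have hSo : IsOpen S := hW.preimage (by fun_prop : Continuous fun q : ℝ × ℝ => (t₂, q))
    have hSc : IsPreconnected S := by
      have e : S = Prod.snd '' {z | z ∈ W ∧ z.1 = t₂} := by
        ext q
        constructor
        · intro hq
          exact ⟨(t₂, q), ⟨hq, rfl⟩, rfl⟩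
        · rintro ⟨⟨t', q'⟩, ⟨h1, h2⟩, rfl⟩
          obtain rfl : t' = t₂ := h2
          exact h1
      rw [e]
      exact (hsec t₂).image _ continuous_snd.continuousOn
    have hd : ∀ q ∈ S, HasFDerivAt (fun q => f (t₂, q)) (0 : ℝ × ℝ →L[ℝ] ℝ) q := by
      intro q hq
      have h1 : HasFDerivAt (fun q : ℝ × ℝ => (t₂, q))
          ((0 : ℝ × ℝ →L[ℝ] ℝ).prod (ContinuousLinearMap.id ℝ (ℝ × ℝ))) q :=
        (hasFDerivAt_const _ _).prodMk (hasFDerivAt_id q)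
      have h2 := ((hf _ hq).differentiableAt (by simp)).hasFDerivAt.comp
        (f := fun q : ℝ × ℝ => (t₂, q)) q h1
      have h3 : (fderiv ℝ f (t₂, q)).comp
          ((0 : ℝ × ℝ →L[ℝ] ℝ).prod (ContinuousLinearMap.id ℝ (ℝ × ℝ))) = 0 := by
        ext
        · exact hx _ hq
        · exact hv _ hq
      rwa [h3] at h2
    exact hSo.is_const_of_fderiv_eq_zero (𝕜 := ℝ) hSc
      (fun q hq => (hd q hq).differentiableAt.differentiableWithinAt)
      (fun q hq => (hd q hq).fderiv) hy hy'
  classical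
  refine ⟨fun t => if h : ∃ z ∈ W, z.1 = t then f h.choose else 0, ?_, ?_⟩
  · rintro _ ⟨⟨t, q⟩, hz, rfl⟩
    have hc : Continuous fun s : ℝ => (s, q) := by fun_prop
    have hs : ContDiffAt ℝ ∞ (fun s => f (s, q)) t :=
      (hf _ hz).comp (f := fun s : ℝ => (s, q)) t (contDiffAt_id.prodMk contDiffAt_const)
    refine (hs.congr_of_eventuallyEq ?_).contDiffWithinAt
    filter_upwards [(hW.preimage hc).mem_nhds hz] with s hs
    have he : ∃ z ∈ W, z.1 = s := ⟨(s, q), hs, rfl⟩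
    simp only [he, dite_true]
    exact hconst s _ he.choose_spec.1 _ hs he.choose_spec.2 rfl
  · intro z hz
    have he : ∃ y ∈ W, y.1 = z.1 := ⟨z, hz, rfl⟩
    simp only [he, dite_true]
    exact hconst z.1 _ hz _ he.choose_spec.1 rfl he.choose_spec.2

/-- The determining equations are integrated on a connected open set with connected sections. -/
theorem AdmissibleTriple.hasAdmissibleForm {E E' : ImagedEquation} {T X V : ℝ × ℝ × ℝ → ℝ}
    {W : Set (ℝ × ℝ × ℝ)} (h : AdmissibleTriple E E' T X V W) (hW : IsConnected W)
    (hsec : ∀ t : ℝ, IsPreconnected {z | z ∈ W ∧ z.1 = t}) :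
    HasAdmissibleForm E E' (fun z => (T z, X z, V z)) W := by
  have D := fun z (hz : z ∈ W) => h.determiningEquations hz
  obtain ⟨τ, hτ, hTτ⟩ := exists_eq_comp_fst h.isOpen hsec h.smooth_T (fun z hz => (D z hz).T_x)
    (fun z hz => (D z hz).T_v)
  have hO : IsOpen (Prod.fst '' W) := isOpenMap_fst W h.isOpen
  have hTt : ∀ z ∈ W, dirD (1, 0, 0) T z = deriv τ z.1 := by
    intro z hz
    rw [dirD_affine (g := fun _ => 0) (k := τ) h.isOpen (fun y hy => by simp [hTτ y hy]) hz
      (hasDerivAt_const _ _) ((hτ.contDiffAt (hO.mem_nhds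
        (mem_image_of_mem _ hz))).differentiableAt (by simp)).hasDerivAt]
    ring
  have hpos : ∀ t ∈ Prod.fst '' W, 0 < deriv τ t := by
    rintro _ ⟨z, hz, rfl⟩
    rw [← hTt z hz]
    exact (D z hz).T_t_pos
  -- the sign of `X_x` is constant because `W` is connected
  obtain ⟨δ, hδ, hXx⟩ : ∃ δ : ℝ, (δ = 1 ∨ δ = -1) ∧
      ∀ z ∈ W, dirD (0, 1, 0) X z = δ * √(dirD (1, 0, 0) T z) := by
    have c1 : ContinuousOn (dirD (0, 1, 0) X) W := fun z hz =>
      ((h.smooth_X z hz).dirD _).continuousAt.continuousWithinAt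
    have c2 : ContinuousOn (fun z => √(dirD (1, 0, 0) T z)) W := fun z hz =>
      ((h.smooth_T z hz).dirD _).continuousAt.sqrt.continuousWithinAt
    rcases hW.isPreconnected.eq_or_eq_neg_of_sq_eq c1 c2
      (fun z hz => by
        simp only [Pi.pow_apply]
        rw [(D z hz).X_x_sq, Real.sq_sqrt (D z hz).T_t_pos.le])
      (fun {z} hz => (Real.sqrt_pos.2 (D z hz).T_t_pos).ne') with e | e
    · exact ⟨1, Or.inl rfl, fun z hz => by rw [e hz, one_mul]⟩
    · exact ⟨-1, Or.inr rfl, fun z hz => by rw [e hz, Pi.neg_apply, neg_one_mul]⟩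
  -- `X - X_x x` is a function of `t`, since `X_xx = X_xv = X_v = 0`
  have hder : ∀ w : ℝ × ℝ × ℝ, ∀ z ∈ W,
      dirD w (fun y : ℝ × ℝ × ℝ => X y - dirD (0, 1, 0) X y * y.2.1) z
        = dirD w X z - (dirD (0, 1, 0) X z * w.2.1 + z.2.1 * dirD w (dirD (0, 1, 0) X) z) := by
    intro w z hz
    have := (((h.smooth_X z hz).differentiableAt (by simp)).hasFDerivAt.sub
      ((((h.smooth_X z hz).dirD (0, 1, 0)).differentiableAt (by simp)).hasFDerivAt.mul
      ((ContinuousLinearMap.fst ℝ ℝ ℝ).comp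
        (ContinuousLinearMap.snd ℝ ℝ (ℝ × ℝ))).hasFDerivAt)).fderiv
    rw [dirD]
    erw [this]
    simp [dirD]
  obtain ⟨χ, hχ, hXχ⟩ := exists_eq_comp_fst h.isOpen hsec
    (f := fun y => X y - dirD (0, 1, 0) X y * y.2.1)
    (fun z hz => (h.smooth_X z hz).sub (((h.smooth_X z hz).dirD _).mul contDiffAt_snd.fst))
    (fun z hz => by rw [hder _ z hz, h.dirD_dirD_X hz 0]; ring)
    (fun z hz => by rw [hder _ z hz, h.dirD_v_dirD_X hz, (D z hz).X_v]; ring)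
  have hX : ∀ z ∈ W, X z = δ * √(deriv τ z.1) * z.2.1 + χ z.1 := by
    intro z hz
    rw [← hXχ z hz, hXx z hz, hTt z hz]; ring
  obtain ⟨z₀, hz₀⟩ := hW.nonempty
  refine ⟨δ, τ, χ, hδ, hτ, hχ, hpos, fun t x v hz => ?_, (D z₀ hz₀).ε_eq⟩
  obtain ⟨d1, d2, d3⟩ := partials_of_form h.isOpen hτ hχ hpos hTτ hX hz
  have d4 := hTt _ hz
  have d5 : dirD (0, 1, 0) X (t, x, v) = δ * √(deriv τ t) := by rw [hXx _ hz, d4]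
  have hp : 0 < deriv τ t := hpos t ⟨_, hz, rfl⟩
  have hF := (D _ hz).F_eq
  have hH := (D _ hz).H_eq
  rw [d4, d5, d3, hX _ hz] at hF
  rw [d4, d2, hX _ hz] at hH
  simp only at hF hH
  refine ⟨?_, ?_, ?_⟩
  · simp only
    rw [hTτ _ hz, hX _ hz, (D _ hz).V_eq, d4]
  · have hsq := Real.sq_sqrt hp.le
    have hs := Real.sqrt_pos.2 hp
    refine mul_left_cancel₀ hp.ne' (hF.trans ?_)
    rw [sqrt_pow_three hp.le]
    generalize √(deriv τ t) = s at *
    rw [← hsq]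
    field_simp
    ring
  · field_simp
    linear_combination hH

theorem mainTheorem4 (E E' : ImagedEquation) (φ : ℝ × ℝ × ℝ → ℝ × ℝ × ℝ)
    (Ω : Set (ℝ × ℝ × ℝ)) (hΩ : IsOpen Ω) (hE : Ω ⊆ E.domain) (hE' : MapsTo φ Ω E'.domain) :
    -- locally, on an arbitrary open set
    (IsAdmissible E E' φ Ω ↔
      ∀ z ∈ Ω, ∃ W : Set (ℝ × ℝ × ℝ), IsOpen W ∧ z ∈ W ∧ W ⊆ Ω ∧ HasAdmissibleForm E E' φ W) ∧
    -- globally, if `Ω` and its sections by the planes `t = const` are connected (e.g. a box)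
    (IsConnected Ω → (∀ t : ℝ, IsPreconnected {z | z ∈ Ω ∧ z.1 = t}) →
      (IsAdmissible E E' φ Ω ↔ HasAdmissibleForm E E' φ Ω)) := by
  have triple : ∀ W ⊆ Ω, IsOpen W → IsAdmissible E E' φ Ω →
      AdmissibleTriple E E' (fun z => (φ z).1) (fun z => (φ z).2.1) (fun z => (φ z).2.2) W := by
    intro W hWΩ hW h
    have hs : ∀ z ∈ W, ContDiffAt ℝ ∞ φ z := fun z hz =>
      h.point.smooth.contDiffAt (hΩ.mem_nhds (hWΩ hz))
    exact ⟨hW, ⟨⟨h.point.smooth.mono hWΩ, fun z hz => h.point.jacobian_ne_zero z (hWΩ hz)⟩,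
      fun u u' p hp => h.connects u u' p (hWΩ hp)⟩, fun z hz => (hs z hz).fst,
      fun z hz => (hs z hz).snd.fst, fun z hz => (hs z hz).snd.snd⟩
  have local_imp : (∀ z ∈ Ω, ∃ W : Set (ℝ × ℝ × ℝ), IsOpen W ∧ z ∈ W ∧ W ⊆ Ω ∧
      HasAdmissibleForm E E' φ W) → IsAdmissible E E' φ Ω := by
    intro h
    have key : ∀ z ∈ Ω, (ContDiffAt ℝ ∞ (fun z => (φ z).1) z ∧
        ContDiffAt ℝ ∞ (fun z => (φ z).2.1) z ∧ ContDiffAt ℝ ∞ (fun z => (φ z).2.2) z) ∧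
        DeterminingEquations E E' (fun z => (φ z).1) (fun z => (φ z).2.1) (fun z => (φ z).2.2) z := by
      intro z hz
      obtain ⟨W, hW, hzW, -, hf⟩ := h z hz
      obtain ⟨h1, h2⟩ := determiningEquations_of_form (T := fun z => (φ z).1)
        (X := fun z => (φ z).2.1) (V := fun z => (φ z).2.2) hW hf
      exact ⟨h1 z hzW, h2 z hzW⟩
    exact isAdmissible_of_determiningEquations hΩ (fun z hz => (key z hz).1.1)
      (fun z hz => (key z hz).1.2.1) (fun z hz => (key z hz).1.2.2) (fun z hz => (key z hz).2)
  refine ⟨⟨fun h z hz => ?_, local_imp⟩, fun hc hsec => ⟨fun h => ?_, fun h => ?_⟩⟩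
  · obtain ⟨r, hr, hb⟩ := Metric.isOpen_iff.1 hΩ z hz
    refine ⟨Metric.ball z r, Metric.isOpen_ball, Metric.mem_ball_self hr, hb, ?_⟩
    refine (triple _ hb Metric.isOpen_ball h).hasAdmissibleForm
      ((convex_ball z r).isConnected ⟨z, Metric.mem_ball_self hr⟩) fun t => ?_
    have hl : IsLinearMap ℝ (fun y : ℝ × ℝ × ℝ => y.1) := ⟨fun _ _ => rfl, fun _ _ => rfl⟩
    exact ((convex_ball z r).inter (convex_hyperplane hl t)).isPreconnected
  · exact (triple Ω subset_rfl hΩ h).hasAdmissibleForm hc hsec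
  · exact local_imp fun z hz => ⟨Ω, hΩ, hz, subset_rfl, h⟩
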